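/- For $q\in\mathbb N=\{1,2,\dots\}$ let $[x]_q=\lfloor qx\rfloor/q$, applied componentwise to vectors. Let $H(\cdot)$ and $H(\cdot\mid\cdot)$ denote the discrete (conditional) entropy in bits, where the conditioning variable may be an arbitrary random vector. A random vector belongs to $\mathcal L$ if it is distributed as $AZ$, where $A$ is a real $n\times k$ matrix and $Z=(Z_1,\dots,Z_k)$ has independent components whose laws are nonsingular (each is a sum of a discrete measure and of a measure absolutely continuous with respect to Lebesgue measure). The Rényi information dimension (RID) and the conditional RID are $$d(X)=\lim_{q\to\infty}\frac{H([X]_q)}{\log_2 q},\qquad d(X\mid Y)=\lim_{q\to\infty}\frac{H([X]_q\mid Y)}{\log_2 q}$$ whenever these limits exist. Let $(X_i,Y_i)_{i\ge 1}$ be a two-terminal memoryless source, that is, an i.i.d. sequence of pairs of real random variables, such that $(X_1,Y_1)\in\mathcal L$ and $X_1,Y_1$ have finite second moments. Let $N$ range over an increasing sequence of block lengths and, for each such $N$, let $\Phi^x_N$ and $\Phi^y_N$ be real matrices of dimensions $m^x_N\times N$ and $m^y_N\times N$; write $X_1^N=(X_1,\dots,X_N)$ and $Y_1^N=(Y_1,\dots,Y_N)$.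 Let $\epsilon,\rho_x,\rho_y\in[0,\infty)$ and suppose that the family $\{\Phi^x_N,\Phi^y_N\}$ is $\epsilon$-REP (restricted iso-entropy property) with measurement rate $(\rho_x,\rho_y)$, that is, for every $N$ in the sequence $$\limsup_{q\to\infty}\frac{H([X_1^N]_q,[Y_1^N]_q\mid \Phi^x_NX_1^N,\Phi^y_NY_1^N)}{H([X_1^N]_q,[Y_1^N]_q)}\le\epsilon$$ (with the convention $0/0=0$), and $$\limsup_{N\to\infty}\frac{m^x_N}{N}\le\rho_x,\qquad \limsup_{N\to\infty}\frac{m^y_N}{N}\le\rho_y .$$ Then the limits defining $d(X,Y)=d((X_1,Y_1))$, $d(X\mid Y)=d(X_1\mid Y_1)$ and $d(Y\mid X)=d(Y_1\mid X_1)$ exist and are finite, and $$\rho_x+\rho_y\ \ge\ d(X,Y)\,(1-\epsilon),\qquad \rho_x\ \ge\ d(X\mid Y)-\epsilon\, d(X,Y),\qquad \rho_y\ \ge\ d(Y\mid X)-\epsilon\, d(X,Y).$$ -/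

import Mathlib

open MeasureTheory ProbabilityTheory Filter Topology
open scoped ENNReal NNReal

namespace RenyiDim

noncomputable section

/-- The uniform quantization `[x]_q = ⌊q x⌋ / q`. -/
def quant (q : ℕ) (x : ℝ) : ℝ := (⌊(q : ℝ) * x⌋ : ℝ) / (q : ℝ)

/-- Componentwise uniform quantization of a real vector. -/
def quantVec {n : ℕ} (q : ℕ) (x : Fin n → ℝ) : Fin n → ℝ := fun i => quant q (x i)

/-- The discrete Shannon entropy, in bits and with values in `[0, ∞]`, of a law `μ` that is
carried by a countable set: the sum over all atoms `a` of `-μ{a} log₂ μ{a}`. -/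
def entropy {α : Type*} [MeasurableSpace α] (μ : Measure α) : ℝ≥0∞ :=
  ∑' a : α, ENNReal.ofReal (Real.negMulLog (μ.real {a}) / Real.log 2)

/-- The conditional entropy `H(D | W)` of a discrete random variable `D` given an arbitrary
random element `W`: the average over `w`, distributed as `W`, of the entropy of the regular
conditional law of `D` given `W = w`. -/
def condEntropy {Ω α β : Type*} [MeasurableSpace Ω] [MeasurableSpace α] [StandardBorelSpace α]
    [Nonempty α] [MeasurableSpace β] (P : Measure Ω) [IsFiniteMeasure P]
    (D : Ω → α) (W : Ω → β) : ℝ≥0∞ :=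
  ∫⁻ w, entropy (condDistrib D W P w) ∂(P.map W)

/-- A law on `ℝ` without singular part: the sum of a discrete part (carried by a countable set)
and of a part that is absolutely continuous with respect to Lebesgue measure. -/
def IsNonsingular (μ : Measure ℝ) : Prop :=
  ∃ μd μc : Measure ℝ, μ = μd + μc ∧ (∃ S : Set ℝ, S.Countable ∧ μd Sᶜ = 0) ∧ μc ≪ volume

/-- The random vector `X` belongs to the class `𝓛`: it is distributed as `A Z`, where `A` is a
real matrix and `Z` is a random vector with independent nonsingular components (`ν j` is the law
of the `j`-th component of `Z`, so that `Measure.pi ν` is the law of `Z`). -/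
def MemL {Ω : Type*} [MeasurableSpace Ω] (P : Measure Ω) {n : ℕ} (X : Ω → Fin n → ℝ) : Prop :=
  ∃ (k : ℕ) (A : Matrix (Fin n) (Fin k) ℝ) (ν : Fin k → Measure ℝ),
    (∀ j, IsProbabilityMeasure (ν j)) ∧ (∀ j, IsNonsingular (ν j)) ∧
      P.map X = (Measure.pi ν).map (fun z => A.mulVec z)

/-- The Rényi information dimension of the random vector `X` exists and equals `d`:
`lim_{q → ∞} H([X]_q) / log₂ q = d`. -/
def HasRID {Ω : Type*} [MeasurableSpace Ω] (P : Measure Ω) {n : ℕ} (X : Ω → Fin n → ℝ)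
    (d : ℝ≥0) : Prop :=
  Tendsto (fun q : ℕ => entropy (P.map (fun ω => quantVec q (X ω))) /
    ENNReal.ofReal (Real.logb 2 (q : ℝ))) atTop (𝓝 (d : ℝ≥0∞))

/-- The conditional Rényi information dimension of the random vector `X` given `W` exists and
equals `d`: `lim_{q → ∞} H([X]_q | W) / log₂ q = d`. -/
def HasCondRID {Ω β : Type*} [MeasurableSpace Ω] [MeasurableSpace β] (P : Measure Ω)
    [IsFiniteMeasure P] {n : ℕ} (X : Ω → Fin n → ℝ) (W : Ω → β) (d : ℝ≥0) : Prop :=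
  Tendsto (fun q : ℕ => condEntropy P (fun ω => quantVec q (X ω)) W /
    ENNReal.ofReal (Real.logb 2 (q : ℝ))) atTop (𝓝 (d : ℝ≥0∞))

/-- `(X i, Y i)`, `i = 0, 1, 2, …`, is a two-terminal memoryless source: a sequence of independent
and identically distributed random pairs. -/
structure IsMemorylessSource {Ω : Type*} [MeasurableSpace Ω] (P : Measure Ω)
    (X Y : ℕ → Ω → ℝ) : Prop where
  measurable_fst : ∀ i, Measurable (X i)
  measurable_snd : ∀ i, Measurable (Y i)
  indep : iIndepFun (fun i ω => (X i ω, Y i ω)) P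
  ident : ∀ i, IdentDistrib (fun ω => (X i ω, Y i ω)) (fun ω => (X 0 ω, Y 0 ω)) P P

/-- The block of the first `N` samples of a sequence of random variables. -/
def block {Ω : Type*} (X : ℕ → Ω → ℝ) (N : ℕ) (ω : Ω) : Fin N → ℝ := fun i => X i ω

/-- The distributed family of measurement matrices `(Φx l, Φy l)`, of dimensions `mx l × N l` and
`my l × N l` along a subsequence `N 0 < N 1 < …` of block lengths, is `ε`-REP (restricted
iso-entropy property) for the source `(X i, Y i)` with measurement rate `(ρx, ρy)`. -/
structure IsREP {Ω : Type*} [MeasurableSpace Ω] (P : Measure Ω) [IsFiniteMeasure P]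
    (X Y : ℕ → Ω → ℝ) (N mx my : ℕ → ℕ)
    (Φx : ∀ l, Matrix (Fin (mx l)) (Fin (N l)) ℝ) (Φy : ∀ l, Matrix (Fin (my l)) (Fin (N l)) ℝ)
    (ε ρx ρy : ℝ≥0) : Prop where
  index : StrictMono N
  isometry : ∀ l, limsup (fun q : ℕ =>
      condEntropy P (fun ω => (quantVec q (block X (N l) ω), quantVec q (block Y (N l) ω)))
          (fun ω => ((Φx l).mulVec (block X (N l) ω), (Φy l).mulVec (block Y (N l) ω))) /
        entropy (P.map
          (fun ω => (quantVec q (block X (N l) ω), quantVec q (block Y (N l) ω))))) atTop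
      ≤ (ε : ℝ≥0∞)
  rate_fst : limsup (fun l => (mx l : ℝ≥0∞) / (N l : ℝ≥0∞)) atTop ≤ (ρx : ℝ≥0∞)
  rate_snd : limsup (fun l => (my l : ℝ≥0∞) / (N l : ℝ≥0∞)) atTop ≤ (ρy : ℝ≥0∞)

end

end RenyiDim

/-! Let S_j be a countable set carrying the discrete part of the law of Z_j, and call pattern of z
the set T of the coordinates with z_j ∉ S_j. On the event that the pattern is T, the coordinates in
T have a joint density and the others take countably many values. So AZ is spread over countably
many translates of A(ℝ^T), and its quantization costs about dim A(ℝ^T) · log₂ q bits. Hence d(AZ) is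
the mean of dim A(ℝ^T) over the pattern.

The upper bound `entropy_quantVec_le` is a Gibbs inequality. Its reference measure gives mass of
order q^(-dim A(ℝ^T)) to each cell met by finitely many bounded pieces of the translates, and mass
of order q^(-n), with Laplace tails, to all other cells.

The lower bound `lintegral_le_liminf_condEntropy` concerns the entropy given any W. Suppose that r
directions supported in T leave W fixed and are separated by the quantizer at scale 1/q. Along a
slice in these directions the conditional law does not change. By Fubini and Markov it gives mass at
least q^(-(r-η)) to the current cell only on a part of the slice of volume O(q^(-η)). By absolute
continuity the probability of this event tends to 0. With the chain rule and rank–nullity this also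
identifies d(X|Y) as the mean dimension of A(ℝ^T) ∩ {y = 0}.

For the theorem, the lower bound is applied to a block of N samples with W the measurements. The
directions are the product of the spaces A(ℝ^(T_i)), cut by at most m_x + m_y linear equations, so
the conditional entropy is at least about (N d(X,Y) - m_x - m_y) log₂ q. The REP bounds it by about
ε N d(X,Y) log₂ q; dividing by N gives the bound on the sum rate. If only directions with vanishing
Y-part are kept, the equations of Φ^y hold automatically. Then only m_x is lost, and d(X|Y) takes
the place of d(X,Y) on the left; the third bound is symmetric. -/

namespace RenyiDim

noncomputable section

/-- The self-information, in bits, of an event of probability `p`. -/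
def info (p : ℝ) : ℝ≥0∞ := ENNReal.ofReal (-Real.logb 2 p)

@[fun_prop]
lemma measurable_info : Measurable info := by
  unfold info Real.logb
  fun_prop

lemma ofReal_negMulLog_div (p : ℝ) (hp : 0 ≤ p) :
    ENNReal.ofReal (Real.negMulLog p / Real.log 2) = info p * ENNReal.ofReal p := by
  rw [info, ← ENNReal.ofReal_mul' hp, Real.negMulLog, Real.logb]
  congr 1
  ring

/-! ### Entropy as mean self-information, and the Gibbs inequality. -/

section Entropy

variable {α : Type*} [MeasurableSpace α] [MeasurableSingletonClass α]

omit [MeasurableSingletonClass α] in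
lemma entropy_eq_tsum_of_countable (μ : Measure α) [IsFiniteMeasure μ] {R : Set α}
    (h0 : μ Rᶜ = 0) :
    entropy μ = ∑' a : R, info (μ.real {(a : α)}) * μ {(a : α)} := by
  have h : ∀ a, ENNReal.ofReal (Real.negMulLog (μ.real {a}) / Real.log 2)
      = info (μ.real {a}) * μ {a} := fun a => by
    rw [ofReal_negMulLog_div _ measureReal_nonneg, ofReal_measureReal]
  rw [entropy, ← tsum_subtype_eq_of_support_subset (s := R)]
  · exact tsum_congr fun a => h a
  · intro a ha
    by_contra hR
    apply ha
    have h1 : μ {a} = 0 := measure_mono_null (by simpa using hR) h0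
    change ENNReal.ofReal (Real.negMulLog (μ.real {a}) / Real.log 2) = 0
    rw [h, h1, mul_zero]

lemma entropy_eq_lintegral (μ : Measure α) [IsFiniteMeasure μ] {R : Set α}
    (hR : R.Countable) (h0 : μ Rᶜ = 0) : entropy μ = ∫⁻ a, info (μ.real {a}) ∂μ := by
  have h1 : ∫⁻ a, info (μ.real {a}) ∂μ = ∫⁻ a in R, info (μ.real {a}) ∂μ := by
    rw [Measure.restrict_eq_self_of_ae_mem (s := R) (μ := μ) h0]
  rw [entropy_eq_tsum_of_countable μ h0, h1, lintegral_countable _ hR]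

/-- This is log x ≤ x - 1 at x = q / p, with the term -p dropped. Summed over the atoms, the extra q
costs at most the total mass of the reference measure, which therefore need not be normalized. -/
lemma negMulLog_le_cross {p q : ℝ} (hp : 0 < p) (hq : 0 < q) :
    -Real.log p * p ≤ -Real.log q * p + q := by
  have h := Real.log_le_sub_one_of_pos (div_pos hq hp)
  rw [Real.log_div hq.ne' hp.ne'] at h
  have h2 : q / p * p = q := by field_simp
  nlinarith

/-- The Gibbs inequality, up to an additive constant, for an unnormalized reference measure. -/
lemma entropy_le_lintegral_info (μ Q : Measure α) [IsFiniteMeasure μ] [IsFiniteMeasure Q]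
    {R : Set α} (hR : R.Countable) (h0 : μ Rᶜ = 0) (hQ : ∀ᵐ a ∂μ, Q {a} ≠ 0) :
    entropy μ ≤ ∫⁻ a, info (Q.real {a}) ∂μ + Q Set.univ / ENNReal.ofReal (Real.log 2) := by
  have hl : 0 < Real.log 2 := Real.log_pos one_lt_two
  rw [entropy_eq_tsum_of_countable μ h0]
  conv_rhs => enter [1]; rw [← Measure.restrict_eq_self_of_ae_mem (s := R) (μ := μ) h0]
  rw [lintegral_countable _ hR]
  have h1 : ∑' a : R, Q {(a : α)} ≤ Q Set.univ :=
    (tsum_meas_le_meas_iUnion_of_disjoint Q (fun a => measurableSet_singleton _)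
      (fun a b hab => by simpa [Function.onFun] using fun h => hab (Subtype.ext h))).trans
      (measure_mono (Set.subset_univ _))
  calc _ ≤ ∑' a : R, (info (Q.real {(a : α)}) * μ {(a : α)}
            + Q {(a : α)} / ENNReal.ofReal (Real.log 2)) := by
        refine ENNReal.tsum_le_tsum fun a => ?_
        by_cases hp : μ {(a : α)} = 0
        · simp [hp]
        have hq : Q {(a : α)} ≠ 0 := by
          intro hq
          exact hp (measure_mono_null (by simpa using hq) hQ)
        have hp' : 0 < μ.real {(a : α)} := ENNReal.toReal_pos hp (measure_ne_top _ _)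
        have hq' : 0 < Q.real {(a : α)} := ENNReal.toReal_pos hq (measure_ne_top _ _)
        rw [← ofReal_measureReal (μ := μ), ← ofReal_measureReal (μ := Q), info, info,
          ← ENNReal.ofReal_mul' hp'.le, ← ENNReal.ofReal_mul' hp'.le,
          ← ENNReal.ofReal_div_of_pos hl]
        refine le_trans (ENNReal.ofReal_le_ofReal ?_) ENNReal.ofReal_add_le
        have := div_le_div_of_nonneg_right (negMulLog_le_cross hp' hq') hl.le
        simp only [Real.logb]
        have h2 : ∀ x y : ℝ, -(x / Real.log 2) * y = -x * y / Real.log 2 := fun x y => by ring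
        rw [h2, h2, ← add_div]
        exact this
    _ = ∑' a : R, info (Q.real {(a : α)}) * μ {(a : α)}
          + (∑' a : R, Q {(a : α)}) / ENNReal.ofReal (Real.log 2) := by
        rw [ENNReal.tsum_add]
        simp_rw [div_eq_mul_inv, ENNReal.tsum_mul_right]
    _ ≤ _ := by gcongr

omit [MeasurableSingletonClass α] in
lemma measure_singleton_ae_ne_zero (μ : Measure α) {R : Set α}
    (hR : R.Countable) (h0 : μ Rᶜ = 0) : ∀ᵐ a ∂μ, μ {a} ≠ 0 := by
  have h1 : μ {a | a ∈ R ∧ μ {a} = 0} = 0 := by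
    have hc : {a | a ∈ R ∧ μ {a} = 0}.Countable := hR.mono fun a ha => ha.1
    rw [← Set.biUnion_of_singleton {a | a ∈ R ∧ μ {a} = 0}, measure_biUnion_null_iff hc]
    exact fun a ha => ha.2
  refine measure_mono_null (t := Rᶜ ∪ {a | a ∈ R ∧ μ {a} = 0}) ?_ (measure_union_null h0 h1)
  intro a ha
  simp only [ne_eq, Set.mem_compl_iff, Set.mem_ofPred_eq, not_not, Set.mem_union] at ha ⊢
  tauto

end Entropy

/-! ### Conditional entropy: Gibbs inequality, chain rule, independent blocks. -/

section CondEntropy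

variable {Ω Ω' α β γ : Type*} [MeasurableSpace Ω] [MeasurableSpace Ω']
  [MeasurableSpace α] [StandardBorelSpace α] [Nonempty α] [MeasurableSpace β] [MeasurableSpace γ]

-- The singleton is a section of the diagonal, which is measurable because `α` is standard Borel.
omit [Nonempty α] in
lemma measurable_kernel_singleton (κ : Kernel β α) [IsFiniteKernel κ] :
    Measurable fun p : β × α => (κ p.1).real {p.2} := by
  refine Measurable.ennreal_toReal ?_
  have h := Kernel.measurable_kernel_prodMk_left (κ := Kernel.prodMkRight α κ)
    (t := {p : (β × α) × α | p.2 = p.1.2})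
    (measurableSet_eq_fun measurable_snd (measurable_snd.comp measurable_fst))
  exact h

/-- The regular conditional law is built from the joint law alone. This permits computing on the
space of the independent components Z instead of Ω. -/
lemma condEntropy_congr (P : Measure Ω) [IsFiniteMeasure P] (P' : Measure Ω') [IsFiniteMeasure P']
    {D : Ω → α} {W : Ω → β} {D' : Ω' → α} {W' : Ω' → β} (hD : Measurable D) (hD' : Measurable D')
    (h : P.map (fun ω => (W ω, D ω)) = P'.map (fun ω => (W' ω, D' ω))) :
    condEntropy P D W = condEntropy P' D' W' := by
  have h1 : P.map W = P'.map W' := by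
    rw [← Measure.fst_map_prodMk (X := W) hD, ← Measure.fst_map_prodMk (X := W') hD', h]
  unfold condEntropy
  rw [h1]
  simp only [condDistrib, h]

lemma ae_condDistrib_compl (P : Measure Ω) [IsFiniteMeasure P] {D : Ω → α} {W : Ω → β}
    (hD : Measurable D) (hW : Measurable W) {R : Set α} (hR : R.Countable) (hDR : ∀ ω, D ω ∈ R) :
    ∀ᵐ w ∂(P.map W), condDistrib D W P w Rᶜ = 0 := by
  have hRm : MeasurableSet Rᶜ := hR.measurableSet.compl
  have h := setLIntegral_condDistrib_of_measurableSet (μ := P) hW hD.aemeasurable hRm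
    (t := Set.univ) MeasurableSet.univ
  have h0 : D ⁻¹' Rᶜ = ∅ := by
    ext ω; simp [hDR ω]
  rw [Measure.restrict_univ, h0] at h
  simp only [Set.inter_empty, measure_empty] at h
  rw [← lintegral_map (f := fun w => condDistrib D W P w Rᶜ)
    (Kernel.measurable_coe _ hRm) hW, lintegral_eq_zero_iff (Kernel.measurable_coe _ hRm)] at h
  exact h

lemma condEntropy_eq_lintegral (P : Measure Ω) [IsFiniteMeasure P] {D : Ω → α} {W : Ω → β}
    (hD : Measurable D) (hW : Measurable W) {R : Set α} (hR : R.Countable) (hDR : ∀ ω, D ω ∈ R) :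
    condEntropy P D W = ∫⁻ ω, info ((condDistrib D W P (W ω)).real {D ω}) ∂P := by
  have hm : Measurable fun p : β × α => info ((condDistrib D W P p.1).real {p.2}) :=
    measurable_info.comp (measurable_kernel_singleton _)
  have h : condEntropy P D W
      = ∫⁻ w, ∫⁻ a, info ((condDistrib D W P w).real {a}) ∂(condDistrib D W P w) ∂(P.map W) := by
    refine lintegral_congr_ae ?_
    filter_upwards [ae_condDistrib_compl P hD hW hR hDR] with w hw
    exact entropy_eq_lintegral _ hR hw
  rw [h, ← Measure.lintegral_compProd hm, compProd_map_condDistrib hD.aemeasurable,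
    lintegral_map hm (hW.prodMk hD)]

/-- The conditional Gibbs inequality. -/
lemma condEntropy_le_lintegral_info (P : Measure Ω) [IsFiniteMeasure P] {D : Ω → α} {W : Ω → β}
    (hD : Measurable D) (hW : Measurable W) {R : Set α} (hR : R.Countable) (hDR : ∀ ω, D ω ∈ R)
    (Q : Kernel β α) [IsMarkovKernel Q] (hQ : ∀ᵐ ω ∂P, Q (W ω) {D ω} ≠ 0) :
    condEntropy P D W ≤ ∫⁻ ω, info ((Q (W ω)).real {D ω}) ∂P
      + P Set.univ / ENNReal.ofReal (Real.log 2) := by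
  have hm : Measurable fun p : β × α => info ((Q p.1).real {p.2}) :=
    measurable_info.comp (measurable_kernel_singleton _)
  have hQm : MeasurableSet {p : β × α | Q p.1 {p.2} ≠ 0} := by
    have : {p : β × α | Q p.1 {p.2} ≠ 0} = {p : β × α | (Q p.1).real {p.2} ≠ 0} := by
      ext p
      simp [measureReal_eq_zero_iff]
    rw [this]
    exact (measurable_kernel_singleton Q) (measurableSet_singleton 0).compl
  have hQ' : ∀ᵐ w ∂(P.map W), ∀ᵐ a ∂(condDistrib D W P w), Q w {a} ≠ 0 := by
    apply Measure.ae_ae_of_ae_compProd (p := fun p : β × α => Q p.1 {p.2} ≠ 0)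
    rw [compProd_map_condDistrib hD.aemeasurable, ae_map_iff (hW.prodMk hD).aemeasurable hQm]
    exact hQ
  calc condEntropy P D W
      ≤ ∫⁻ w, (∫⁻ a, info ((Q w).real {a}) ∂(condDistrib D W P w)
        + 1 / ENNReal.ofReal (Real.log 2)) ∂(P.map W) := by
        refine lintegral_mono_ae ?_
        filter_upwards [ae_condDistrib_compl P hD hW hR hDR, hQ'] with w hw hw'
        have := entropy_le_lintegral_info (condDistrib D W P w) (Q w) hR hw hw'
        rwa [measure_univ] at this
    _ = _ := by
        rw [lintegral_add_right _ measurable_const, ← Measure.lintegral_compProd hm,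
          compProd_map_condDistrib hD.aemeasurable, lintegral_map hm (hW.prodMk hD),
          lintegral_const, Measure.map_apply hW MeasurableSet.univ, Set.preimage_univ]
        rw [one_div, mul_comm, ← div_eq_mul_inv]

lemma condDistrib_self_singleton_ae_ne_zero (P : Measure Ω) [IsFiniteMeasure P] {D : Ω → α}
    {W : Ω → β} (hD : Measurable D) (hW : Measurable W) {R : Set α} (hR : R.Countable)
    (hDR : ∀ ω, D ω ∈ R) : ∀ᵐ ω ∂P, condDistrib D W P (W ω) {D ω} ≠ 0 := by
  set Q := condDistrib D W P with hQdef
  have hQm : MeasurableSet {p : β × α | Q p.1 {p.2} ≠ 0} := by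
    have : {p : β × α | Q p.1 {p.2} ≠ 0} = {p : β × α | (Q p.1).real {p.2} ≠ 0} := by
      ext p
      simp [measureReal_eq_zero_iff]
    rw [this]
    exact (measurable_kernel_singleton Q) (measurableSet_singleton 0).compl
  have h : ∀ᵐ p ∂(P.map W ⊗ₘ Q), Q p.1 {p.2} ≠ 0 := by
    rw [Measure.ae_compProd_iff hQm]
    filter_upwards [ae_condDistrib_compl P hD hW hR hDR] with w hw
    exact measure_singleton_ae_ne_zero _ hR hw
  rw [compProd_map_condDistrib hD.aemeasurable, ae_map_iff (hW.prodMk hD).aemeasurable hQm] at h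
  exact h

/-- Conditioning on more information does not increase the entropy by more than a constant. -/
lemma condEntropy_le_condEntropy_comp (P : Measure Ω) [IsFiniteMeasure P] {D : Ω → α} {W : Ω → β}
    (hD : Measurable D) (hW : Measurable W) {R : Set α} (hR : R.Countable) (hDR : ∀ ω, D ω ∈ R)
    {f : β → γ} (hf : Measurable f) :
    condEntropy P D W ≤ condEntropy P D (fun ω => f (W ω))
      + P Set.univ / ENNReal.ofReal (Real.log 2) := by
  -- The reference kernel is the conditional law given the coarser variable. The surplus constant of
  -- the Gibbs inequality disappears after division by log₂ q.
  have h := condEntropy_le_lintegral_info P hD hW hR hDR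
    ((condDistrib D (fun ω => f (W ω)) P).comap f hf) ?_
  · rwa [condEntropy_eq_lintegral P hD (W := fun ω => f (W ω)) (hf.comp hW) hR hDR]
  · exact condDistrib_self_singleton_ae_ne_zero P hD (hf.comp hW) hR hDR

lemma entropy_map_eq_lintegral (P : Measure Ω) [IsFiniteMeasure P] {D : Ω → γ}
    [MeasurableSingletonClass γ] (hD : Measurable D) {R : Set γ} (hR : R.Countable)
    (hDR : ∀ ω, D ω ∈ R) :
    entropy (P.map D) = ∫⁻ ω, info (P.real (D ⁻¹' {D ω})) ∂P := by
  have hRm := hR.measurableSet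
  have h0 : P.map D Rᶜ = 0 := by
    rw [Measure.map_apply hD hRm.compl]
    convert measure_empty (μ := P)
    ext ω; simp [hDR ω]
  rw [entropy_eq_tsum_of_countable _ h0]
  have h1 : ∫⁻ ω, info (P.real (D ⁻¹' {D ω})) ∂P
      = ∑' a : R, ∫⁻ ω in D ⁻¹' {(a : γ)}, info (P.real (D ⁻¹' {D ω})) ∂P := by
    have := hR.to_subtype
    rw [← lintegral_iUnion (fun a => hD (measurableSet_singleton _))]
    · have : ⋃ a : R, D ⁻¹' {(a : γ)} = Set.univ := by
        ext ω; simp [hDR ω]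
      rw [this, Measure.restrict_univ]
    · intro a b hab
      refine Set.disjoint_left.2 fun ω h1 h2 => hab (Subtype.ext ?_)
      simp only [Set.mem_preimage, Set.mem_singleton_iff] at h1 h2
      exact h1.symm.trans h2
  rw [h1]
  refine tsum_congr fun a => ?_
  have h2 : ∫⁻ ω in D ⁻¹' {(a : γ)}, info (P.real (D ⁻¹' {D ω})) ∂P
      = ∫⁻ ω in D ⁻¹' {(a : γ)}, info (P.real (D ⁻¹' {(a : γ)})) ∂P := by
    refine setLIntegral_congr_fun (hD (measurableSet_singleton _)) fun ω hω => ?_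
    simp only [Set.mem_preimage, Set.mem_singleton_iff] at hω
    simp only [hω]
  rw [h2, lintegral_const, Measure.restrict_apply_univ, measureReal_def,
    Measure.map_apply hD (measurableSet_singleton _), measureReal_def]

lemma measurable_measure_preimage_singleton [MeasurableSingletonClass γ] (P : Measure Ω)
    {D : Ω → γ} (hD : Measurable D) {R : Set γ} (hR : R.Countable) (hDR : ∀ ω, D ω ∈ R) :
    Measurable fun ω => P.real (D ⁻¹' {D ω}) := by
  have := hR.to_subtype
  have h : Measurable fun ω => (⟨D ω, hDR ω⟩ : R) := hD.subtype_mk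
  exact (measurable_from_top (f := fun a : R => P.real (D ⁻¹' {(a : γ)}))).comp
    (h.mono le_rfl fun s _ => (Set.to_countable s).measurableSet)

/-- Makes lower bounds for conditional entropies available for plain entropies. -/
lemma condEntropy_const (P : Measure Ω) [IsProbabilityMeasure P] {D : Ω → α} (hD : Measurable D) :
    condEntropy P D (fun _ => ()) = entropy (P.map D) := by
  have hW : Measurable fun _ : Ω => () := measurable_const
  have h1 : P.map (fun _ : Ω => ()) = Measure.dirac () := by
    rw [Measure.map_const, measure_univ, one_smul]
  unfold condEntropy
  rw [h1, lintegral_dirac]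
  congr 1
  ext s hs
  have h := setLIntegral_condDistrib_of_measurableSet (μ := P) hW hD.aemeasurable hs
    (t := Set.univ) MeasurableSet.univ
  rw [Measure.map_apply hD hs]
  simpa using h

/-- The bounds by 1 matter: `info` truncates negative values to 0, so additivity can fail above 1.
-/
lemma info_mul {p q : ℝ} (hp : 0 < p) (hp1 : p ≤ 1) (hq : 0 < q) (hq1 : q ≤ 1) :
    info (p * q) = info p + info q := by
  have h : ∀ x : ℝ, 0 < x → x ≤ 1 → 0 ≤ -Real.logb 2 x := fun x hx hx1 =>
    neg_nonneg.2 (Real.logb_nonpos one_lt_two hx.le hx1)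
  rw [info, info, info, ← ENNReal.ofReal_add (h p hp hp1) (h q hq hq1),
    Real.logb_mul hp.ne' hq.ne']
  congr 1
  ring

lemma preimage_singleton_ae_ne_zero [MeasurableSingletonClass γ] (P : Measure Ω)
    {D : Ω → γ} (hD : Measurable D) {R : Set γ} (hR : R.Countable) (hDR : ∀ ω, D ω ∈ R) :
    ∀ᵐ ω ∂P, P (D ⁻¹' {D ω}) ≠ 0 := by
  have hRm := hR.measurableSet
  have h0 : P.map D Rᶜ = 0 := by
    rw [Measure.map_apply hD hRm.compl]
    convert measure_empty (μ := P)
    ext ω; simp [hDR ω]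
  have h := ae_of_ae_map hD.aemeasurable (measure_singleton_ae_ne_zero _ hR h0)
  filter_upwards [h] with ω hω
  rwa [Measure.map_apply hD (measurableSet_singleton _)] at hω

/-- The chain rule for discrete random variables. -/
lemma condEntropy_add_entropy (P : Measure Ω) [IsProbabilityMeasure P] {D : Ω → α} {W : Ω → γ}
    [MeasurableSingletonClass γ] (hD : Measurable D) (hW : Measurable W) {R : Set α}
    (hR : R.Countable) (hDR : ∀ ω, D ω ∈ R) {S : Set γ} (hS : S.Countable) (hWS : ∀ ω, W ω ∈ S) :
    condEntropy P D W + entropy (P.map W) = entropy (P.map fun ω => (D ω, W ω)) := by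
  have hDW : ∀ ω, (D ω, W ω) ∈ R ×ˢ S := fun ω => ⟨hDR ω, hWS ω⟩
  rw [condEntropy_eq_lintegral P hD hW hR hDR, entropy_map_eq_lintegral P hW hS hWS,
    entropy_map_eq_lintegral P (hD.prodMk hW) (hR.prod hS) hDW, ← lintegral_add_right]
  · refine lintegral_congr_ae ?_
    filter_upwards [preimage_singleton_ae_ne_zero P hW hS hWS,
      preimage_singleton_ae_ne_zero P (hD.prodMk hW) (hR.prod hS) hDW] with ω h1 h2
    have h3 : P.map W {W ω} ≠ 0 := by
      rwa [Measure.map_apply hW (measurableSet_singleton _)]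
    have h4 := condDistrib_apply_of_ne_zero (μ := P) hD (W ω) h3 {D ω}
    have h5 : (fun ω => (D ω, W ω)) ⁻¹' {(D ω, W ω)} = W ⁻¹' {W ω} ∩ D ⁻¹' {D ω} := by
      ext x; simp [and_comm]
    have h6 : (condDistrib D W P (W ω)).real {D ω} * P.real (W ⁻¹' {W ω})
        = P.real ((fun ω => (D ω, W ω)) ⁻¹' {(D ω, W ω)}) := by
      rw [measureReal_def, h4, Measure.map_apply hW (measurableSet_singleton _), h5,
        Measure.map_apply (hW.prodMk hD) ((measurableSet_singleton _).prod
          (measurableSet_singleton _)), measureReal_def, measureReal_def, ← ENNReal.toReal_mul,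
        Set.mk_preimage_prod, mul_comm, ← mul_assoc, ENNReal.mul_inv_cancel h1 (measure_ne_top _ _),
        one_mul]
    have hpos : 0 < P.real ((fun ω => (D ω, W ω)) ⁻¹' {(D ω, W ω)}) :=
      ENNReal.toReal_pos h2 (measure_ne_top _ _)
    have hq : 0 < P.real (W ⁻¹' {W ω}) := ENNReal.toReal_pos h1 (measure_ne_top _ _)
    rw [← h6] at hpos ⊢
    rw [info_mul ((pos_iff_pos_of_mul_pos hpos).2 hq) measureReal_le_one hq measureReal_le_one]
  · exact measurable_info.comp (measurable_measure_preimage_singleton P hW hS hWS)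

/-- The entropy of a block of independent identically distributed discrete random variables. -/
lemma entropy_map_pi {N : ℕ} (P : Measure Ω) [IsProbabilityMeasure P] {D : Fin N → Ω → γ}
    [MeasurableSingletonClass γ] (hD : ∀ i, Measurable (D i)) {R : Set γ} (hR : R.Countable)
    (hDR : ∀ i ω, D i ω ∈ R) (hind : iIndepFun D P) :
    entropy (P.map fun ω i => D i ω) = ∑ i, entropy (P.map (D i)) := by
  have hRR : (Set.univ.pi fun _ : Fin N => R).Countable := Set.countable_univ_pi fun _ => hR
  have hDm : Measurable fun ω i => D i ω := measurable_pi_lambda _ hD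
  rw [entropy_map_eq_lintegral P hDm hRR (fun ω i _ => hDR i ω)]
  simp_rw [fun i => entropy_map_eq_lintegral P (hD i) hR (hDR i)]
  rw [← lintegral_finsetSum (f := fun i ω => info (P.real (D i ⁻¹' {D i ω}))) _
    fun i _ => measurable_info.comp
      (measurable_measure_preimage_singleton P (hD i) hR (hDR i))]
  have hae : ∀ᵐ ω ∂P, ∀ i, P (D i ⁻¹' {D i ω}) ≠ 0 :=
    ae_all_iff.2 fun i => preimage_singleton_ae_ne_zero P (hD i) hR (hDR i)
  refine lintegral_congr_ae ?_
  filter_upwards [hae] with ω hω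
  have h1 : (fun ω i => D i ω) ⁻¹' {fun i => D i ω} = ⋂ i, D i ⁻¹' {D i ω} := by
    ext x; simp [funext_iff]
  have h2 : P.real ((fun ω i => D i ω) ⁻¹' {fun i => D i ω}) = ∏ i, P.real (D i ⁻¹' {D i ω}) := by
    rw [h1, measureReal_def]
    have := hind.measure_inter_preimage_eq_mul Finset.univ (sets := fun i => {D i ω})
      (fun i _ => measurableSet_singleton _)
    simp only [Finset.mem_univ, Set.iInter_true] at this
    rw [this, ENNReal.toReal_prod]
    rfl
  have h3 : ∀ s : Finset (Fin N), info (∏ i ∈ s, P.real (D i ⁻¹' {D i ω}))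
      = ∑ i ∈ s, info (P.real (D i ⁻¹' {D i ω})) := by
    have hpos : ∀ i, 0 < P.real (D i ⁻¹' {D i ω}) := fun i =>
      ENNReal.toReal_pos (hω i) (measure_ne_top _ _)
    intro s
    induction s using Finset.induction_on with
    | empty => simp [info]
    | insert i s hi ih =>
      rw [Finset.prod_insert hi, Finset.sum_insert hi, ← ih, info_mul (hpos i) measureReal_le_one]
      · exact Finset.prod_pos fun j _ => hpos j
      · exact Finset.prod_le_one (fun j _ => (hpos j).le) fun j _ => measureReal_le_one
  rw [h2, h3]

end CondEntropy

/-! ### Absolute continuity of finite products and of vanishing sets. -/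

section AbsolutelyContinuous

lemma pi_absolutelyContinuous {ι : Type*} [Fintype ι] {X : Type*} [MeasurableSpace X]
    (μ ν : ι → Measure X) [∀ i, SigmaFinite (μ i)] [∀ i, SigmaFinite (ν i)]
    (h : ∀ i, μ i ≪ ν i) : Measure.pi μ ≪ Measure.pi ν := by
  refine Fintype.induction_empty_option (P := fun ι _ => ∀ μ ν : ι → Measure X,
    (∀ i, SigmaFinite (μ i)) → (∀ i, SigmaFinite (ν i)) → (∀ i, μ i ≪ ν i) →
      Measure.pi μ ≪ Measure.pi ν) ?_ ?_ ?_ ι μ ν inferInstance inferInstance h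
  · intro α β _ e ih μ ν _ _ h
    let _ := Fintype.ofEquiv β e.symm
    have h1 := ih (fun i => μ (e i)) (fun i => ν (e i)) (fun _ => inferInstance)
      (fun _ => inferInstance) fun i => h (e i)
    rw [← Measure.pi_map_piCongrLeft (β := fun _ => X) e μ,
      ← Measure.pi_map_piCongrLeft (β := fun _ => X) e ν]
    exact h1.map (MeasurableEquiv.measurable _)
  · intro μ ν _ _ _
    rw [Measure.pi_of_empty, Measure.pi_of_empty]
  · intro α _ ih μ ν _ _ h
    have h1 := ih (fun i => μ (some i)) (fun i => ν (some i)) (fun _ => inferInstance)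
      (fun _ => inferInstance) fun i => h _
    rw [← Measure.pi_map_piOptionEquivProd μ, ← Measure.pi_map_piOptionEquivProd ν]
    exact (h1.prod (h none)).map (MeasurableEquiv.measurable _)

/-- The density of μ is integrable because μ is finite, so its integral is absolutely continuous in
the set; ν itself may be infinite. -/
lemma tendsto_measure_zero_of_absolutelyContinuous {X : Type*} [MeasurableSpace X]
    {μ ν : Measure X} [IsFiniteMeasure μ] [SigmaFinite ν] (h : μ ≪ ν) {E : ℕ → Set X}
    (hE : ∀ q, MeasurableSet (E q)) (h0 : Tendsto (fun q => ν (E q)) atTop (𝓝 0)) :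
    Tendsto (fun q => μ (E q)) atTop (𝓝 0) := by
  have h1 : ∫⁻ x, μ.rnDeriv ν x ∂ν ≠ ∞ := (Measure.lintegral_rnDeriv_lt_top μ ν).ne
  have h2 := tendsto_setLIntegral_zero h1 h0
  refine h2.congr fun q => ?_
  conv_rhs => rw [← Measure.withDensity_rnDeriv_eq μ ν h]
  rw [withDensity_apply _ (hE q)]

end AbsolutelyContinuous

/-! ### Sets with small slices are small for translation-invariant measures. -/

section Translation

variable {κ : Type*} [Fintype κ] {r : ℕ}

lemma pi_map_add_eq_self (lam : κ → Measure ℝ) [∀ j, SigmaFinite (lam j)] (a : κ → ℝ)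
    (h : ∀ j, (lam j).map (fun x => x + a j) = lam j) :
    (Measure.pi lam).map (fun z => z + a) = Measure.pi lam := by
  have : ∀ j, SigmaFinite ((lam j).map fun x => x + a j) := fun j => by rw [h]; infer_instance
  have h1 := Measure.pi_map_pi (μ := lam) (f := fun j x => x + a j)
    fun j => (measurable_id.add_const _).aemeasurable
  simp_rw [h] at h1
  exact h1

/-- Averaging over the translates in the directions of the range of `G` bounds the measure of a
bounded set by the volume of its slices. -/
lemma measure_mul_volume_ball_le (lam : Measure (κ → ℝ)) [SigmaFinite lam]
    (G : (Fin r → ℝ) →L[ℝ] (κ → ℝ)) (h : ∀ v, lam.map (fun z => z + G v) = lam)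
    {E : Set (κ → ℝ)} (hE : MeasurableSet E) {R : ℝ} (hER : E ⊆ Metric.closedBall 0 R)
    {η : ℝ≥0∞} (hη : ∀ z, volume {v | z + G v ∈ E} ≤ η) :
    lam E * volume (Metric.ball (0 : Fin r → ℝ) 1)
      ≤ η * lam (Metric.closedBall 0 (R + ‖G‖)) := by
  have hm : Measurable fun p : (κ → ℝ) × (Fin r → ℝ) => p.1 + G p.2 := by fun_prop
  have h1 : ∀ v, lam E = ∫⁻ z, E.indicator 1 (z + G v) ∂lam := fun v => by
    rw [← lintegral_map (f := E.indicator 1) (g := fun z => z + G v)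
      (measurable_one.indicator hE) (by fun_prop), h v, lintegral_indicator_one hE]
  calc lam E * volume (Metric.ball (0 : Fin r → ℝ) 1)
      = ∫⁻ v in Metric.ball (0 : Fin r → ℝ) 1, ∫⁻ z, E.indicator 1 (z + G v) ∂lam := by
        simp_rw [← h1]
        rw [lintegral_const, Measure.restrict_apply_univ]
    _ = ∫⁻ z, (∫⁻ v in Metric.ball (0 : Fin r → ℝ) 1, E.indicator 1 (z + G v)) ∂lam := by
        refine lintegral_lintegral_swap ?_
        exact (((measurable_one.indicator hE).comp hm).comp measurable_swap).aemeasurable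
    _ ≤ ∫⁻ z, (Metric.closedBall 0 (R + ‖G‖)).indicator (fun _ => η) z ∂lam := by
        refine lintegral_mono fun z => ?_
        by_cases hz : z ∈ Metric.closedBall 0 (R + ‖G‖)
        · rw [Set.indicator_of_mem hz]
          calc _ ≤ ∫⁻ v, E.indicator 1 (z + G v) := setLIntegral_le_lintegral _ _
            _ = ∫⁻ v, {v | z + G v ∈ E}.indicator 1 v := rfl
            _ ≤ η := by
              rw [lintegral_indicator_one]
              · exact hη z
              · exact (hm.comp measurable_prodMk_left) hE
        -- For unit `v` the translation by `G v` moves points by at most `‖G‖`, so from such a `z`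
        -- it cannot reach `E`.
        · rw [Set.indicator_of_notMem hz, nonpos_iff_eq_zero]
          rw [setLIntegral_eq_zero_iff measurableSet_ball]
          · refine ae_of_all _ fun v hv => ?_
            refine Set.indicator_of_notMem (fun hE' => hz ?_) _
            have h2 := hER hE'
            simp only [Metric.mem_closedBall, dist_zero_right, Metric.mem_ball] at h2 hv ⊢
            have h3 := G.le_opNorm v
            have h4 : ‖z‖ ≤ ‖z + G v‖ + ‖G v‖ := by
              simpa using norm_sub_le (z + G v) (G v)
            have h5 : ‖G‖ * ‖v‖ ≤ ‖G‖ := mul_le_of_le_one_right (norm_nonneg _) hv.le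
            linarith
          · exact (measurable_one.indicator hE).comp (hm.comp measurable_prodMk_left)
    _ = _ := by
        rw [lintegral_indicator measurableSet_closedBall, lintegral_const,
          Measure.restrict_apply_univ]

/-- On a fixed ball, averaging over translates makes the `lam`-measure small, and absolute
continuity passes this to `μ`. The complement of a large ball is negligible because `μ` is finite.
-/
lemma tendsto_measure_zero_of_slices (μ lam : Measure (κ → ℝ)) [IsFiniteMeasure μ]
    [SigmaFinite lam] [IsLocallyFiniteMeasure lam] (hac : μ ≪ lam)
    (G : (Fin r → ℝ) →L[ℝ] (κ → ℝ)) (h : ∀ v, lam.map (fun z => z + G v) = lam)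
    {B : ℕ → Set (κ → ℝ)} (hB : ∀ q, MeasurableSet (B q))
    {η : ℕ → ℝ≥0∞} (hη0 : Tendsto η atTop (𝓝 0))
    (hη : ∀ᶠ q in atTop, ∀ z, volume {v | z + G v ∈ B q} ≤ η q) :
    Tendsto (fun q => μ (B q)) atTop (𝓝 0) := by
  have hR : ∀ R : ℝ, Tendsto (fun q => μ (B q ∩ Metric.closedBall 0 R)) atTop (𝓝 0) := by
    intro R
    refine tendsto_measure_zero_of_absolutelyContinuous hac
      (fun q => (hB q).inter measurableSet_closedBall) ?_
    have hv0 : volume (Metric.ball (0 : Fin r → ℝ) 1) ≠ 0 :=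
      (Metric.measure_ball_pos _ _ one_pos).ne'
    have hvt : volume (Metric.ball (0 : Fin r → ℝ) 1) ≠ ∞ := measure_ball_lt_top.ne
    have hlt : lam (Metric.closedBall 0 (R + ‖G‖)) ≠ ∞ :=
      (isCompact_closedBall _ _).measure_lt_top.ne
    have hlim : Tendsto (fun q => η q * lam (Metric.closedBall 0 (R + ‖G‖))
        / volume (Metric.ball (0 : Fin r → ℝ) 1)) atTop (𝓝 0) := by
      have h1 := ENNReal.Tendsto.mul_const hη0 (b := lam (Metric.closedBall 0 (R + ‖G‖))
        / volume (Metric.ball (0 : Fin r → ℝ) 1)) (Or.inr (ENNReal.div_ne_top hlt hv0))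
      rw [zero_mul] at h1
      refine h1.congr fun q => ?_
      rw [mul_div_assoc]
    refine tendsto_of_tendsto_of_tendsto_of_le_of_le' tendsto_const_nhds hlim
      (Eventually.of_forall fun _ => zero_le) ?_
    filter_upwards [hη] with q hq
    rw [ENNReal.le_div_iff_mul_le (Or.inl hv0) (Or.inl hvt)]
    refine measure_mul_volume_ball_le lam G h ((hB q).inter measurableSet_closedBall)
      Set.inter_subset_right fun z => (measure_mono fun v hv => ?_).trans (hq z)
    exact hv.1
  have htail : Tendsto (fun n : ℕ => μ (Metric.closedBall 0 (n : ℝ))ᶜ) atTop (𝓝 0) := by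
    have h1 := tendsto_measure_iInter_atTop (μ := μ)
      (s := fun n : ℕ => (Metric.closedBall (0 : κ → ℝ) (n : ℝ))ᶜ)
      (fun n => measurableSet_closedBall.compl.nullMeasurableSet)
      (fun m n hmn => Set.compl_subset_compl.2
        (Metric.closedBall_subset_closedBall (Nat.cast_le.2 hmn)))
      ⟨0, measure_ne_top _ _⟩
    have h2 : ⋂ n : ℕ, (Metric.closedBall (0 : κ → ℝ) (n : ℝ))ᶜ = ∅ := by
      rw [← Set.compl_iUnion, Metric.iUnion_closedBall_nat, Set.compl_univ]
    rwa [h2, measure_empty] at h1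
  rw [ENNReal.tendsto_nhds_zero]
  intro ε hε
  obtain ⟨n, hn⟩ := (ENNReal.tendsto_nhds_zero.1 htail (ε / 2) (ENNReal.half_pos hε.ne')).exists
  filter_upwards [ENNReal.tendsto_nhds_zero.1 (hR n) (ε / 2) (ENNReal.half_pos hε.ne')] with q hq
  calc μ (B q) ≤ μ (B q ∩ Metric.closedBall 0 n) + μ (Metric.closedBall 0 (n : ℝ))ᶜ := by
        refine (measure_mono fun z hz => ?_).trans (measure_union_le _ _)
        by_cases h : z ∈ Metric.closedBall (0 : κ → ℝ) (n : ℝ)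
        · exact Or.inl ⟨hz, h⟩
        · exact Or.inr h
    _ ≤ ε / 2 + ε / 2 := add_le_add hq hn
    _ = ε := ENNReal.add_halves ε

end Translation

/-- The set of coordinates that lie outside the given sets `S j`. -/
def pattern {κ : Type*} (S : κ → Set ℝ) (z : κ → ℝ) : Set κ := {j | z j ∉ S j}

lemma measurable_pattern {κ : Type*} {S : κ → Set ℝ} (hS : ∀ j, MeasurableSet (S j)) :
    Measurable (pattern S) := by
  rw [measurable_set_iff]
  intro j
  exact measurable_mem.2 (show MeasurableSet {z : κ → ℝ | z j ∈ (S j)ᶜ} from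
    (measurable_pi_apply j) (hS j).compl)

-- The pattern event is a box, so restricting a product measure to it again gives a product measure.
open Classical in
lemma pattern_preimage_singleton {κ : Type*} (S : κ → Set ℝ) (T : Set κ) :
    pattern S ⁻¹' {T} = Set.univ.pi fun j => if j ∈ T then (S j)ᶜ else S j := by
  ext z
  simp only [Set.mem_preimage, Set.mem_singleton_iff, Set.mem_pi, Set.mem_univ, true_imp_iff,
    Set.ext_iff]
  refine forall_congr' fun j => ?_
  change (z j ∉ S j ↔ j ∈ T) ↔ _
  split_ifs with h <;> simp [h]

/-! ### Lower bound for the conditional entropy by resolved directions. -/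

section LowerBound

variable {κ : Type*} [Fintype κ] {β : Type*} [MeasurableSpace β]
  {α : Type*} [MeasurableSpace α] [StandardBorelSpace α]

/-- Markov's inequality reduces the claim to the integral of K{f v} over v. By Fubini this is the
K-mean of the volumes of the fibres of f, and a nonempty fibre lies in a sup-norm ball of radius b.
-/
lemma volume_setOf_le_measure_singleton_le {r : ℕ} (K : Measure α) [IsProbabilityMeasure K]
    {f : (Fin r → ℝ) → α} (hf : Measurable f) {b t : ℝ}
    (hb : ∀ v v', f v = f v' → ‖v - v'‖ ≤ b) :
    ENNReal.ofReal t * volume {v | t ≤ K.real {f v}} ≤ ENNReal.ofReal ((2 * b) ^ r) := by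
  have hE : MeasurableSet {p : (Fin r → ℝ) × α | p.2 = f p.1} :=
    measurableSet_eq_fun measurable_snd (hf.comp measurable_fst)
  have h1 : {v | t ≤ K.real {f v}} = {v | ENNReal.ofReal t ≤ K {f v}} := by
    ext v
    exact (ENNReal.ofReal_le_iff_le_toReal (measure_ne_top _ _)).symm
  have hfib : ∀ a, volume ((fun v => (v, a)) ⁻¹' {p : (Fin r → ℝ) × α | p.2 = f p.1})
      ≤ ENNReal.ofReal ((2 * b) ^ r) := by
    intro a
    rcases Set.eq_empty_or_nonempty
      ((fun v => (v, a)) ⁻¹' {p : (Fin r → ℝ) × α | p.2 = f p.1}) with h | ⟨v0, hv0⟩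
    · rw [h, measure_empty]; exact zero_le
    · have hb0 : 0 ≤ b := by simpa using hb v0 v0 rfl
      refine (measure_mono fun v hv => ?_).trans
        (Real.volume_pi_closedBall v0 hb0 |>.trans (by rw [Fintype.card_fin])).le
      have h2 : a = f v := hv
      have h3 : a = f v0 := hv0
      rw [Metric.mem_closedBall, dist_eq_norm]
      exact hb v v0 (h2.symm.trans h3)
  calc ENNReal.ofReal t * volume {v | t ≤ K.real {f v}}
      ≤ ∫⁻ v, K {f v} := by
        rw [h1]
        exact mul_meas_ge_le_lintegral (measurable_measure_prodMk_left hE) _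
    _ = (volume.prod K) {p : (Fin r → ℝ) × α | p.2 = f p.1} := (Measure.prod_apply hE).symm
    _ = ∫⁻ a, volume ((fun v => (v, a)) ⁻¹' {p : (Fin r → ℝ) × α | p.2 = f p.1}) ∂K :=
        Measure.prod_apply_symm hE
    _ ≤ ∫⁻ _, ENNReal.ofReal ((2 * b) ^ r) ∂K := lintegral_mono hfib
    _ = _ := by simp

/-- Vectors along which the coordinates in `T` move freely, `W` is constant and the quantizers
`D q` separate points at scale `1 / q`. -/
structure IsResolved (D : ℕ → (κ → ℝ) → α) (W : (κ → ℝ) → β) (T : Set κ) {r : ℕ}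
    (G : (Fin r → ℝ) →ₗ[ℝ] (κ → ℝ)) : Prop where
  support : ∀ v, ∀ j ∉ T, G v j = 0
  invariant : ∀ z v, W (z + G v) = W z
  separated : ∃ C : ℝ, ∀ q : ℕ, 1 ≤ q → ∀ z v v', D q (z + G v) = D q (z + G v') →
    ‖v - v'‖ ≤ C / q

variable [Nonempty α]

-- Along a slice in the directions `G` the condition `W` is constant, so a single probability
-- measure is evaluated at the cells crossed; it cannot charge too many of them heavily.
open Classical in
lemma tendsto_measure_likely_zero (ν : κ → Measure ℝ) [∀ j, IsProbabilityMeasure (ν j)]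
    {S : κ → Set ℝ} (hν : ∀ j, (ν j).restrict (S j)ᶜ ≪ volume)
    {D : ℕ → (κ → ℝ) → α} (hD : ∀ q, Measurable (D q)) {W : (κ → ℝ) → β} (hW : Measurable W)
    {T : Set κ} {r : ℕ} {G : (Fin r → ℝ) →ₗ[ℝ] (κ → ℝ)} (hG : IsResolved D W T G)
    {η : ℝ} (hη : 0 < η) :
    Tendsto (fun q : ℕ => Measure.pi ν (pattern S ⁻¹' {T} ∩
      {z | (q : ℝ) ^ (-((r : ℝ) - η)) ≤
        (condDistrib (D q) W (Measure.pi ν) (W z)).real {D q z}})) atTop (𝓝 0) := by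
  obtain ⟨C, hC⟩ := hG.separated
  set μ : κ → Measure ℝ := fun j => (ν j).restrict (if j ∈ T then (S j)ᶜ else S j) with hμ
  -- Translations along `G` move only the coordinates in `T`, where the reference is Lebesgue
  -- measure; elsewhere the law itself can be kept. So the product is invariant and dominates the
  -- law.
  set lam : κ → Measure ℝ := fun j => if j ∈ T then volume else μ j with hlam
  have hlf : ∀ j, SigmaFinite (lam j) := fun j => by
    simp only [hlam]; split_ifs <;> infer_instance
  have hll : ∀ j, IsLocallyFiniteMeasure (lam j) := fun j => by
    simp only [hlam]; split_ifs <;> infer_instance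
  have hac : ∀ j, μ j ≪ lam j := fun j => by
    simp only [hlam]
    split_ifs with h
    · simp only [hμ, if_pos h]; exact hν j
    · exact Measure.AbsolutelyContinuous.rfl
  let G' : (Fin r → ℝ) →L[ℝ] (κ → ℝ) := LinearMap.toContinuousLinearMap G
  have hinv : ∀ v, (Measure.pi lam).map (fun z => z + G' v) = Measure.pi lam := fun v => by
    refine pi_map_add_eq_self lam _ fun j => ?_
    by_cases h : j ∈ T
    · simp only [hlam, if_pos h]
      exact map_add_right_eq_self volume _
    · have : G' v j = 0 := hG.support v j h
      simp [this]
  set B : ℕ → Set (κ → ℝ) := fun q => {z | (q : ℝ) ^ (-((r : ℝ) - η)) ≤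
        (condDistrib (D q) W (Measure.pi ν) (W z)).real {D q z}} with hBdef
  have hB : ∀ q, MeasurableSet (B q) := fun q => measurableSet_le measurable_const
    ((measurable_kernel_singleton _).comp (hW.prodMk (hD q)))
  have hlim : Tendsto (fun q : ℕ => ENNReal.ofReal ((2 * C) ^ r * (q : ℝ) ^ (-η)))
      atTop (𝓝 0) := by
    have h1 := ((tendsto_rpow_neg_atTop hη).comp tendsto_natCast_atTop_atTop).const_mul
      ((2 * C) ^ r)
    rw [mul_zero] at h1
    simpa using ENNReal.tendsto_ofReal h1
  have h := tendsto_measure_zero_of_slices (Measure.pi μ) (Measure.pi lam)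
    (pi_absolutelyContinuous μ lam hac) G' hinv hB hlim ?_
  · refine h.congr fun q => ?_
    rw [hμ, ← Measure.restrict_pi_pi, ← pattern_preimage_singleton, Measure.restrict_apply (hB q),
      Set.inter_comm]
  · filter_upwards [eventually_ge_atTop 1] with q hq z
    have hq0 : (0 : ℝ) < q := by exact_mod_cast hq
    have ht : (0 : ℝ) < (q : ℝ) ^ (-((r : ℝ) - η)) := Real.rpow_pos_of_pos hq0 _
    have h1 := volume_setOf_le_measure_singleton_le
      (condDistrib (D q) W (Measure.pi ν) (W z)) (f := fun v => D q (z + G' v))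
      ((hD q).comp (by fun_prop)) (t := (q : ℝ) ^ (-((r : ℝ) - η))) (hC q hq z)
    have h2 : {v | z + G' v ∈ B q} = {v | (q : ℝ) ^ (-((r : ℝ) - η)) ≤
        (condDistrib (D q) W (Measure.pi ν) (W z)).real {D q (z + G' v)}} := by
      ext v
      have h3 : W (z + G' v) = W z := hG.invariant z v
      change _ ≤ (condDistrib (D q) W (Measure.pi ν) (W (z + G' v))).real _ ↔ _
      rw [h3]
      rfl
    -- The fibre volume is of order q^(-r); dividing by the threshold leaves q^(-η), which tends to
    -- 0.
    have h4 : (2 * (C / q)) ^ r = (q : ℝ) ^ (-((r : ℝ) - η)) * ((2 * C) ^ r * (q : ℝ) ^ (-η)) := by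
      rw [mul_left_comm, ← Real.rpow_add hq0, ← mul_div_assoc, div_pow]
      have : -((r : ℝ) - η) + -η = -(r : ℝ) := by ring
      rw [this, Real.rpow_neg hq0.le, Real.rpow_natCast, div_eq_mul_inv]
    rw [h4, ENNReal.ofReal_mul ht.le] at h1
    rw [h2]
    exact (ENNReal.mul_le_mul_iff_right (by simpa using ht) ENNReal.ofReal_ne_top).1 h1

/-- Lower bound for the conditional information dimension: the mean number of directions that are
resolved by the quantizers. -/
theorem lintegral_le_liminf_condEntropy (ν : κ → Measure ℝ) [∀ j, IsProbabilityMeasure (ν j)]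
    {S : κ → Set ℝ} (hS : ∀ j, MeasurableSet (S j)) (hν : ∀ j, (ν j).restrict (S j)ᶜ ≪ volume)
    {D : ℕ → (κ → ℝ) → α} (hD : ∀ q, Measurable (D q)) {W : (κ → ℝ) → β} (hW : Measurable W)
    (hR : ∀ q, ∃ R : Set α, R.Countable ∧ ∀ z, D q z ∈ R)
    (r : Set κ → ℕ) (G : ∀ T, (Fin (r T) → ℝ) →ₗ[ℝ] (κ → ℝ)) (hG : ∀ T, IsResolved D W T (G T)) :
    ∫⁻ z, (r (pattern S z) : ℝ≥0∞) ∂(Measure.pi ν) ≤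
      liminf (fun q : ℕ => condEntropy (Measure.pi ν) (D q) W
        / ENNReal.ofReal (Real.logb 2 (q : ℝ))) atTop := by
  set P := Measure.pi ν with hP
  set L : ℕ → ℝ≥0∞ := fun q => ENNReal.ofReal (Real.logb 2 (q : ℝ)) with hL
  set p : ℕ → (κ → ℝ) → ℝ := fun q z => (condDistrib (D q) W P (W z)).real {D q z} with hp
  have hpm : ∀ q, Measurable (p q) := fun q =>
    (measurable_kernel_singleton _).comp (hW.prodMk (hD q))
  have := Fintype.ofFinite (Set κ)
  obtain ⟨M, hM⟩ : ∃ M : ℕ, ∀ T, r T ≤ M :=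
    ⟨Finset.univ.sup r, fun T => Finset.le_sup (Finset.mem_univ T)⟩
  have hrm : Measurable fun z => r (pattern S z) :=
    (measurable_of_countable r).comp (measurable_pattern hS)
  -- One η is lost in the exponent r - η, the other on the exceptional set, where r is bounded by
  -- `M`.
  suffices H : ∀ η : ℝ≥0, 0 < η → ∫⁻ z, (r (pattern S z) : ℝ≥0∞) ∂P ≤
      liminf (fun q : ℕ => condEntropy P (D q) W / L q) atTop + (η + η) by
    refine ENNReal.le_of_forall_pos_le_add fun ε hε _ => ?_
    have := H (ε / 2) (by positivity)
    rwa [← ENNReal.coe_add, add_halves] at this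
  intro η hη
  have hη' : (0 : ℝ) < η := hη
  set B : ℕ → Set κ → Set (κ → ℝ) := fun q T => pattern S ⁻¹' {T} ∩
      {z | (q : ℝ) ^ (-((r T : ℝ) - η)) ≤ p q z} with hB
  have hBm : ∀ q T, MeasurableSet (B q T) := fun q T =>
    ((measurable_pattern hS) (measurableSet_singleton T)).inter
      (measurableSet_le measurable_const (hpm q))
  have hB0 : ∀ T, Tendsto (fun q => P (B q T)) atTop (𝓝 0) := fun T =>
    tendsto_measure_likely_zero ν hν hD hW (hG T) hη'
  have hsum : Tendsto (fun q => (M : ℝ≥0∞) * ∑ T, P (B q T)) atTop (𝓝 0) := by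
    have h1 := tendsto_finsetSum (Finset.univ : Finset (Set κ)) fun T _ => hB0 T
    have h2 := ENNReal.Tendsto.const_mul (a := (M : ℝ≥0∞)) h1 (Or.inr (ENNReal.natCast_ne_top M))
    simpa using h2
  rw [← tsub_le_iff_right]
  refine le_liminf_of_le (by isBoundedDefault) ?_
  filter_upwards [ENNReal.tendsto_nhds_zero.1 hsum η (by simpa using hη), eventually_ge_atTop 2]
    with q hq hq2
  rw [tsub_le_iff_right]
  have hq0 : (0 : ℝ) < q := by positivity
  have hlog : 0 < Real.logb 2 (q : ℝ) := Real.logb_pos one_lt_two (by exact_mod_cast hq2)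
  set Bad : Set (κ → ℝ) := ⋃ T, B q T with hBad
  have hBadm : MeasurableSet Bad := MeasurableSet.iUnion fun T => hBm q T
  obtain ⟨R, hRc, hDR⟩ := hR q
  have hmain : (∫⁻ z in Badᶜ, ENNReal.ofReal ((r (pattern S z) : ℝ) - η) ∂P) * L q
      ≤ condEntropy P (D q) W := by
    rw [condEntropy_eq_lintegral P (hD q) hW hRc hDR, ← lintegral_mul_const']
    · refine le_trans ?_ (setLIntegral_le_lintegral Badᶜ _)
      refine setLIntegral_mono_ae (measurable_info.comp (hpm q)).aemeasurable ?_
      filter_upwards [condDistrib_self_singleton_ae_ne_zero P (hD q) hW hRc hDR] with z hz hzB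
      have hpos : 0 < p q z := ENNReal.toReal_pos hz (measure_ne_top _ _)
      have hlt : p q z < (q : ℝ) ^ (-((r (pattern S z) : ℝ) - η)) := by
        by_contra hcon
        exact hzB (Set.mem_iUnion.2 ⟨pattern S z, rfl, not_lt.1 hcon⟩)
      rw [hL, info, ← ENNReal.ofReal_mul' hlog.le]
      refine ENNReal.ofReal_le_ofReal ?_
      have h1 := Real.logb_le_logb_of_le one_lt_two hpos hlt.le
      rw [Real.logb_rpow_eq_mul_logb_of_pos hq0] at h1
      change _ ≤ -Real.logb 2 (p q z)
      linarith
    · exact ENNReal.ofReal_ne_top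
  have hdiv : ∫⁻ z in Badᶜ, ENNReal.ofReal ((r (pattern S z) : ℝ) - η) ∂P
      ≤ condEntropy P (D q) W / L q := by
    rw [ENNReal.le_div_iff_mul_le (Or.inl (by simpa [hL] using hlog))
      (Or.inl ENNReal.ofReal_ne_top)]
    exact hmain
  have hbadP : (M : ℝ≥0∞) * P Bad ≤ η := by
    refine le_trans ?_ hq
    gcongr
    exact (measure_iUnion_le _).trans (by rw [tsum_fintype])
  calc ∫⁻ z, (r (pattern S z) : ℝ≥0∞) ∂P
      = ∫⁻ z in Badᶜ, (r (pattern S z) : ℝ≥0∞) ∂P + ∫⁻ z in Bad, (r (pattern S z) : ℝ≥0∞) ∂P := by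
        rw [add_comm, lintegral_add_compl _ hBadm]
    _ ≤ (∫⁻ z in Badᶜ, ENNReal.ofReal ((r (pattern S z) : ℝ) - η) ∂P + η) + η := by
        refine add_le_add ?_ ?_
        · calc _ ≤ ∫⁻ z in Badᶜ, (ENNReal.ofReal ((r (pattern S z) : ℝ) - η) + (η : ℝ≥0∞)) ∂P := by
                refine lintegral_mono fun z => ?_
                rw [← ENNReal.ofReal_coe_nnreal (p := η), ← ENNReal.ofReal_natCast]
                refine le_trans (ENNReal.ofReal_le_ofReal ?_) ENNReal.ofReal_add_le
                linarith
            _ ≤ _ := by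
                rw [lintegral_add_right _ measurable_const, lintegral_const]
                gcongr
                rw [Measure.restrict_apply_univ]
                exact mul_le_of_le_one_right zero_le prob_le_one
        · calc _ ≤ ∫⁻ z in Bad, (M : ℝ≥0∞) ∂P := by
                refine lintegral_mono fun z => ?_
                exact Nat.cast_le.2 (hM _)
            _ = (M : ℝ≥0∞) * P Bad := by rw [lintegral_const, Measure.restrict_apply_univ]
            _ ≤ η := hbadP
    _ ≤ _ := by
        rw [add_assoc]
        gcongr

end LowerBound

/-! ### Cells of the uniform quantizer. -/

section Quantization

lemma quant_eq_iff {q : ℕ} (hq : 1 ≤ q) (x y : ℝ) :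
    quant q y = quant q x ↔ quant q x ≤ y ∧ y < quant q x + 1 / q := by
  have hq0 : (0 : ℝ) < q := by exact_mod_cast hq
  unfold quant
  rw [← add_div, div_le_iff₀ hq0, lt_div_iff₀ hq0, div_left_inj' hq0.ne', Int.cast_inj,
    Int.floor_eq_iff, mul_comm y]

lemma quant_le {q : ℕ} (hq : 1 ≤ q) (x : ℝ) : quant q x ≤ x :=
  ((quant_eq_iff hq x x).1 rfl).1

lemma lt_quant_add {q : ℕ} (hq : 1 ≤ q) (x : ℝ) : x < quant q x + 1 / q :=
  ((quant_eq_iff hq x x).1 rfl).2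

lemma abs_sub_le_of_quant_eq {q : ℕ} (hq : 1 ≤ q) {x y : ℝ} (h : quant q x = quant q y) :
    |x - y| ≤ 1 / q := by
  have h1 := (quant_eq_iff hq x x).1 rfl
  have h2 := (quant_eq_iff hq y y).1 rfl
  rw [h] at h1
  rw [abs_le]
  constructor <;> linarith

@[fun_prop]
lemma measurable_quant (q : ℕ) : Measurable (quant q) := by
  unfold quant
  fun_prop

@[fun_prop]
lemma measurable_quantVec {n : ℕ} (q : ℕ) : Measurable (quantVec (n := n) q) := by
  unfold quantVec
  fun_prop

lemma countable_range_quant (q : ℕ) : (Set.range (quant q)).Countable := by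
  refine (Set.countable_range fun m : ℤ => (m : ℝ) / (q : ℝ)).mono ?_
  rintro _ ⟨x, rfl⟩
  exact ⟨_, rfl⟩

lemma countable_range_quantVec {n : ℕ} (q : ℕ) :
    (Set.range (quantVec (n := n) q)).Countable := by
  refine (Set.countable_univ_pi fun _ : Fin n => countable_range_quant q).mono ?_
  rintro _ ⟨x, rfl⟩ i -
  exact ⟨x i, rfl⟩

lemma quantVec_eq_iff {n : ℕ} {q : ℕ} (hq : 1 ≤ q) (x y : Fin n → ℝ) :
    quantVec q y = quantVec q x ↔
      y ∈ Set.univ.pi fun i => Set.Ico (quant q (x i)) (quant q (x i) + 1 / q) := by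
  simp only [funext_iff, Set.mem_pi, Set.mem_univ, true_imp_iff, Set.mem_Ico]
  exact forall_congr' fun i => quant_eq_iff hq _ _

end Quantization

/-! ### Reference measures for the Gibbs inequality. -/

section ReferenceMeasures

/-- The measure on the line with density `exp (-|x|)`. -/
def laplaceMeasure : Measure ℝ := volume.withDensity fun x => ENNReal.ofReal (Real.exp (-|x|))

instance : IsFiniteMeasure laplaceMeasure := by
  refine isFiniteMeasure_withDensity_ofReal (Integrable.hasFiniteIntegral ?_)
  -- The bound exp(-|x|) ≤ 2 / (1 + x²) follows from 1 + t + t²/2 ≤ exp t for t ≥ 0.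
  refine (integrable_inv_one_add_sq.const_mul 2).mono' (by fun_prop) (ae_of_all _ fun x => ?_)
  rw [Real.norm_eq_abs, Real.abs_exp, Real.exp_neg, ← div_eq_mul_inv, inv_eq_one_div,
    div_le_div_iff₀ (Real.exp_pos _) (by positivity)]
  have h := Real.quadratic_le_exp_of_nonneg (abs_nonneg x)
  have := abs_nonneg x
  have h2 := sq_abs x
  nlinarith

/-- A cell has length 1/q ≤ 1, so |y| ≤ |x| + 1 throughout the cell of x. -/
lemma le_laplaceMeasure_Ico {q : ℕ} (hq : 1 ≤ q) (x : ℝ) :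
    ENNReal.ofReal (Real.exp (-|x| - 1) * (1 / q)) ≤
      laplaceMeasure (Set.Ico (quant q x) (quant q x + 1 / q)) := by
  have hq1 : (1 : ℝ) ≤ q := by exact_mod_cast hq
  have hq2 : (1 : ℝ) / q ≤ 1 := by rw [div_le_one (by linarith)]; exact hq1
  rw [laplaceMeasure, withDensity_apply _ measurableSet_Ico,
    ENNReal.ofReal_mul (Real.exp_pos _).le]
  calc _ = ∫⁻ _ in Set.Ico (quant q x) (quant q x + 1 / q),
        ENNReal.ofReal (Real.exp (-|x| - 1)) := by
        rw [lintegral_const, Measure.restrict_apply_univ, Real.volume_Ico, add_sub_cancel_left]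
    _ ≤ _ := by
        refine setLIntegral_mono' measurableSet_Ico fun y hy => ?_
        refine ENNReal.ofReal_le_ofReal (Real.exp_le_exp.2 ?_)
        have h1 := abs_sub_le_of_quant_eq hq ((quant_eq_iff hq x y).2 hy)
        have h2 := abs_sub_abs_le_abs_sub y x
        linarith

/-- A finite reference law under which every quantized vector has non-negligible mass. -/
def tailMeasure (n q : ℕ) : Measure (Fin n → ℝ) :=
  (Measure.pi fun _ : Fin n => laplaceMeasure).map (quantVec q)

instance (n q : ℕ) : IsFiniteMeasure (tailMeasure n q) := by
  unfold tailMeasure; infer_instance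

lemma tailMeasure_univ (n q : ℕ) : tailMeasure n q Set.univ = laplaceMeasure Set.univ ^ n := by
  rw [tailMeasure, Measure.map_apply (by fun_prop) MeasurableSet.univ, Set.preimage_univ,
    Measure.pi_univ, Finset.prod_const, Finset.card_univ, Fintype.card_fin]

lemma le_tailMeasure_singleton {n q : ℕ} (hq : 1 ≤ q) (x : Fin n → ℝ) :
    ENNReal.ofReal (∏ i, (Real.exp (-|x i| - 1) * (1 / q))) ≤
      tailMeasure n q {quantVec q x} := by
  rw [tailMeasure, Measure.map_apply (by fun_prop) (measurableSet_singleton _)]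
  have h : quantVec q ⁻¹' {quantVec q x} =
      Set.univ.pi fun i => Set.Ico (quant q (x i)) (quant q (x i) + 1 / q) := by
    ext y
    exact quantVec_eq_iff hq x y
  rw [h, Measure.pi_pi, ENNReal.ofReal_prod_of_nonneg fun i _ => by positivity]
  exact Finset.prod_le_prod' fun i _ => le_laplaceMeasure_Ico hq (x i)

/-- The law of the quantization of a dithered uniform point of a piece of the affine subspace
`b + range e`. -/
def affineMeasure {s n : ℕ} (e : (Fin s → ℝ) →L[ℝ] (Fin n → ℝ)) (R : ℝ) (b : Fin n → ℝ) (q : ℕ) :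
    Measure (Fin n → ℝ) :=
  ((volume.restrict (Metric.closedBall (0 : Fin s → ℝ) (R + 1))).prod
    (volume.restrict (Metric.closedBall (0 : Fin n → ℝ) 2))).map
      fun p => quantVec q (e p.1 + b + (1 / q : ℝ) • p.2)

section

variable {s n : ℕ} (e : (Fin s → ℝ) →L[ℝ] (Fin n → ℝ)) (R : ℝ) (b : Fin n → ℝ) (q : ℕ)

lemma measurable_dither :
    Measurable fun p : (Fin s → ℝ) × (Fin n → ℝ) => quantVec q (e p.1 + b + (1 / q : ℝ) • p.2) := by
  fun_prop

instance isFiniteMeasure_restrict_closedBall {m : ℕ} (R : ℝ) :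
    IsFiniteMeasure (volume.restrict (Metric.closedBall (0 : Fin m → ℝ) R)) :=
  isFiniteMeasure_restrict.2 (isCompact_closedBall _ _).measure_lt_top.ne

instance : IsFiniteMeasure (affineMeasure e R b q) := by
  unfold affineMeasure; infer_instance

lemma affineMeasure_univ : affineMeasure e R b q Set.univ =
    volume (Metric.closedBall (0 : Fin s → ℝ) (R + 1)) *
      volume (Metric.closedBall (0 : Fin n → ℝ) 2) := by
  rw [affineMeasure, Measure.map_apply (measurable_dither e b q) MeasurableSet.univ,
    Set.preimage_univ, ← Set.univ_prod_univ, Measure.prod_prod, Measure.restrict_apply_univ,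
    Measure.restrict_apply_univ]

variable {R q}

/-- The dithers that carry p into the cell of x form a cube of side 1. Since p is within 1/q of x,
the cube lies in [-2, 2]^n, whence the radius 2. -/
lemma one_le_volume_dither (hq : 1 ≤ q) {x p : Fin n → ℝ} (h : ‖p - x‖ ≤ 1 / q) :
    1 ≤ volume.restrict (Metric.closedBall (0 : Fin n → ℝ) 2)
      {u | quantVec q (p + (1 / q : ℝ) • u) = quantVec q x} := by
  have hq0 : (0 : ℝ) < q := by exact_mod_cast hq
  have h1 : volume (Set.univ.pi fun i => Set.Ico (q * (quant q (x i) - p i))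
      (q * (quant q (x i) - p i) + 1)) = 1 := by
    rw [Real.volume_pi_Ico]
    simp
  rw [← h1, Measure.restrict_apply]
  · refine measure_mono fun u hu => ⟨?_, ?_⟩
    · change quantVec q (p + (1 / q : ℝ) • u) = quantVec q x
      rw [quantVec_eq_iff hq]
      intro i _
      have hi := hu i trivial
      simp only [Set.mem_Ico, Pi.add_apply, Pi.smul_apply, smul_eq_mul] at hi ⊢
      have h2 : u i = q * (1 / q * u i) := by field_simp
      have h3 : (q : ℝ) * (1 / q) = 1 := by field_simp
      constructor
      · have : (q : ℝ) * (quant q (x i) - p i) ≤ q * (1 / q * u i) := by linarith [hi.1]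
        have := le_of_mul_le_mul_left this hq0
        linarith
      · have : (q : ℝ) * (1 / q * u i) < q * (quant q (x i) - p i + 1 / q) := by
          rw [mul_add, h3]; linarith [hi.2]
        have := lt_of_mul_lt_mul_left this hq0.le
        linarith
    · rw [Metric.mem_closedBall, dist_zero_right, pi_norm_le_iff_of_nonneg (by norm_num)]
      intro i
      have hi := hu i trivial
      simp only [Set.mem_Ico] at hi
      have h2 : |p i - x i| ≤ 1 / q := by
        have := norm_le_pi_norm (p - x) i
        simp only [Pi.sub_apply, Real.norm_eq_abs] at this
        linarith
      rw [abs_le] at h2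
      have h3 := quant_le hq (x i)
      have h4 := lt_quant_add hq (x i)
      have h5 : (q : ℝ) * (1 / q) = 1 := by field_simp
      have h6 : (q : ℝ) * (quant q (x i) - p i) ≤ q * (1 / q) :=
        mul_le_mul_of_nonneg_left (by linarith) hq0.le
      have h7 : (q : ℝ) * (-(1 / q) - 1 / q) ≤ q * (quant q (x i) - p i) :=
        mul_le_mul_of_nonneg_left (by linarith) hq0.le
      have h8 : (q : ℝ) * (-(1 / q) - 1 / q) = -2 := by
        rw [mul_sub, mul_neg, h5]; norm_num
      rw [Real.norm_eq_abs, abs_le]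
      constructor <;> linarith
  · exact (measurable_quantVec q).comp (by fun_prop) (measurableSet_singleton _)

/-- Every w within 1 / ((1 + ‖e‖) q) of v has image within 1/q of that of v, and the dither then
hits the cell with mass at least 1. These w fill a ball of volume of order q^(-s), where s is the
dimension of the affine piece rather than n. Using 1 + ‖e‖ avoids a zero denominator and keeps the
ball inside radius R + 1. -/
lemma le_affineMeasure_singleton (hq : 1 ≤ q) {v : Fin s → ℝ} (hv : ‖v‖ ≤ R) :
    ENNReal.ofReal ((2 * (1 / (1 + ‖e‖)) / q) ^ s) ≤
      affineMeasure e R b q {quantVec q (e v + b)} := by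
  have hq1 : (1 : ℝ) ≤ q := by exact_mod_cast hq
  have hq0 : (0 : ℝ) < q := by linarith
  have hc0 : 0 < 1 + ‖e‖ := by positivity
  have hc1 : 1 / (1 + ‖e‖) ≤ 1 := by
    rw [div_le_one hc0]; linarith [norm_nonneg e]
  have hcq : 1 / (1 + ‖e‖) / q ≤ 1 := by
    rw [div_le_one hq0]; linarith
  rw [affineMeasure, Measure.map_apply (measurable_dither e b q) (measurableSet_singleton _),
    Measure.prod_apply (measurable_dither e b q (measurableSet_singleton _))]
  have hvol : ENNReal.ofReal ((2 * (1 / (1 + ‖e‖)) / q) ^ s)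
      = volume (Metric.closedBall v (1 / (1 + ‖e‖) / q)) := by
    rw [Real.volume_pi_closedBall _ (by positivity), Fintype.card_fin, mul_div_assoc]
  have hsub : Metric.closedBall v (1 / (1 + ‖e‖) / q) ⊆ Metric.closedBall 0 (R + 1) := by
    intro w hw
    rw [Metric.mem_closedBall, dist_eq_norm] at hw ⊢
    have h1 : ‖w‖ ≤ ‖w - v‖ + ‖v‖ := by simpa using norm_add_le (w - v) v
    rw [sub_zero]
    linarith
  calc _ = ∫⁻ w in Metric.closedBall v (1 / (1 + ‖e‖) / q), (1 : ℝ≥0∞) := by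
        rw [hvol, setLIntegral_one]
    _ ≤ ∫⁻ w in Metric.closedBall v (1 / (1 + ‖e‖) / q),
          volume.restrict (Metric.closedBall (0 : Fin n → ℝ) 2)
            {u | quantVec q (e w + b + (1 / q : ℝ) • u) = quantVec q (e v + b)} := by
        refine setLIntegral_mono' measurableSet_closedBall fun w hw => ?_
        refine one_le_volume_dither hq ?_
        rw [Metric.mem_closedBall, dist_eq_norm] at hw
        rw [add_sub_add_right_eq_sub, ← map_sub]
        calc ‖e (w - v)‖ ≤ ‖e‖ * ‖w - v‖ := e.le_opNorm _
          _ ≤ (1 + ‖e‖) * (1 / (1 + ‖e‖) / q) := by gcongr; linarith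
          _ = 1 / q := by field_simp
    _ ≤ _ := lintegral_mono_set hsub

end

end ReferenceMeasures

lemma info_le_of_le {α : Type*} [MeasurableSpace α] {Q : Measure α} [IsFiniteMeasure Q] {a : Set α}
    {x : ℝ} (hx : 0 < x) (h : ENNReal.ofReal x ≤ Q a) :
    info (Q.real a) ≤ ENNReal.ofReal (-Real.logb 2 x) := by
  refine ENNReal.ofReal_le_ofReal (neg_le_neg ?_)
  exact Real.logb_le_logb_of_le one_lt_two hx
    ((ENNReal.ofReal_le_iff_le_toReal (measure_ne_top _ _)).1 h)

section CoordSubspace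

variable {κ : Type*}

/-- The subspace of the vectors whose coordinates outside `T` vanish. -/
def coordSubspace (T : Set κ) : Submodule ℝ (κ → ℝ) where
  carrier := {z | ∀ j ∉ T, z j = 0}
  add_mem' := fun {a b} ha hb j hj => by
    change a j + b j = 0
    rw [ha j hj, hb j hj, add_zero]
  zero_mem' := fun _ _ => rfl
  smul_mem' := fun c a ha j hj => by
    change c * a j = 0
    rw [ha j hj, mul_zero]

lemma mem_coordSubspace {T : Set κ} {z : κ → ℝ} : z ∈ coordSubspace T ↔ ∀ j ∉ T, z j = 0 := Iff.rfl

open Classical in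
/-- The projection onto the coordinates in `T`. -/
def coordProj (T : Set κ) : (κ → ℝ) →ₗ[ℝ] coordSubspace T :=
  LinearMap.codRestrict (coordSubspace T)
    (LinearMap.pi fun j => if j ∈ T then LinearMap.proj j else 0) fun z =>
    mem_coordSubspace.2 fun j hj => by simp [hj]

open Classical in
lemma coordProj_apply (T : Set κ) (z : κ → ℝ) (j : κ) :
    (coordProj T z : κ → ℝ) j = if j ∈ T then z j else 0 := by
  change (if j ∈ T then LinearMap.proj j else (0 : (κ → ℝ) →ₗ[ℝ] ℝ)) z = _
  split_ifs <;> rfl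

end CoordSubspace

/-! ### Upper bound for the entropy of a quantized linear image. -/

section UpperBound

variable {κ : Type*} [Fintype κ] {n : ℕ}

lemma tendsto_measure_setOf_not {X : Type*} [MeasurableSpace X] (μ : Measure X) [IsFiniteMeasure μ]
    {A : Set X} (p : ℕ → X → Prop) (hm : ∀ m, MeasurableSet {x | p m x})
    (hmono : ∀ m m' x, m ≤ m' → p m x → p m' x) (hA : MeasurableSet A)
    (h : ∀ x ∈ A, ∃ m, p m x) : Tendsto (fun m => μ (A ∩ {x | ¬ p m x})) atTop (𝓝 0) := by
  have h1 := tendsto_measure_iInter_atTop (μ := μ) (s := fun m => A ∩ {x | ¬ p m x})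
    (fun m => (hA.inter (hm m).compl).nullMeasurableSet)
    (fun m m' hmm x hx => ⟨hx.1, fun hp => hx.2 (hmono m m' x hmm hp)⟩)
    ⟨0, measure_ne_top _ _⟩
  have h2 : ⋂ m, A ∩ {x | ¬ p m x} = ∅ := by
    refine Set.eq_empty_of_forall_notMem fun x hx => ?_
    have hx' := Set.mem_iInter.1 hx
    obtain ⟨m, hm⟩ := h x (hx' 0).1
    exact (hx' m).2 hm
  rwa [h2, measure_empty] at h1

/-- On most of the event that the pattern is `T`, the vector `g z` lies in a bounded part of a finite
union of translates of the image of the coordinate subspace. -/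
lemma exists_affine_cover (μ : Measure (κ → ℝ)) [IsFiniteMeasure μ] {S : κ → Set ℝ}
    (hS : ∀ j, (S j).Countable) (g : (κ → ℝ) →ₗ[ℝ] (Fin n → ℝ)) (T : Set κ) {ε : ℝ≥0∞}
    (hε : 0 < ε) :
    ∃ (e : (Fin (Module.finrank ℝ ((coordSubspace T).map g)) → ℝ) →L[ℝ] (Fin n → ℝ))
      (R : ℝ) (B : Finset (Fin n → ℝ)) (E : Set (κ → ℝ)), MeasurableSet E ∧
      μ (pattern S ⁻¹' {T} ∩ E) ≤ ε ∧
      ∀ z, pattern S z = T → z ∉ E → ∃ v, ‖v‖ ≤ R ∧ ∃ b ∈ B, g z = e v + b := by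
  classical
  let φ : ((coordSubspace T).map g) ≃ₗ[ℝ]
      (Fin (Module.finrank ℝ ((coordSubspace T).map g)) → ℝ) :=
    LinearEquiv.ofFinrankEq _ _ (by simp)
  let e : (Fin (Module.finrank ℝ ((coordSubspace T).map g)) → ℝ) →L[ℝ] (Fin n → ℝ) :=
    LinearMap.toContinuousLinearMap (((coordSubspace T).map g).subtype ∘ₗ φ.symm.toLinearMap)
  let w : (κ → ℝ) →L[ℝ] (Fin (Module.finrank ℝ ((coordSubspace T).map g)) → ℝ) :=
    LinearMap.toContinuousLinearMap
      (φ.toLinearMap ∘ₗ g.submoduleMap (coordSubspace T) ∘ₗ coordProj T)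
  let off : (κ → ℝ) →L[ℝ] (Fin n → ℝ) := LinearMap.toContinuousLinearMap
    (g - g ∘ₗ (coordSubspace T).subtype ∘ₗ coordProj T)
  have hdec : ∀ z, g z = e (w z) + off z := by
    intro z
    have h1 : e (w z) = g (coordProj T z) := by
      simp [e, w]
    have h2 : off z = g z - g (coordProj T z) := rfl
    rw [h1, h2, add_sub_cancel]
  -- After subtraction of the projection onto the coordinates in `T`, a vector with pattern `T` lies
  -- in this countable set; its image contains all offsets of the translates.
  set c : Set (κ → ℝ) := Set.univ.pi fun j => if j ∈ T then {0} else S j with hc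
  have hcc : (g '' c).Countable := by
    refine Set.Countable.image (Set.countable_univ_pi fun j => ?_) _
    split_ifs
    · exact Set.countable_singleton 0
    · exact hS j
  have hoff : ∀ z, pattern S z = T → off z ∈ g '' c := by
    intro z hz
    refine ⟨z - coordProj T z, ?_, by rw [map_sub]; rfl⟩
    intro j _
    rw [Pi.sub_apply, coordProj_apply]
    split_ifs with h
    · simp [h]
    · rw [sub_zero]
      simp only [if_neg h]
      by_contra hcon
      rw [← hz] at h
      exact h hcon
  have hpm : ∀ (m : ℕ) (F : Finset (Fin n → ℝ)), MeasurableSet {z | ‖w z‖ ≤ m ∧ off z ∈ F} :=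
    fun m F => (measurableSet_le (f := fun z => ‖w z‖) (by fun_prop) measurable_const).inter
      (off.measurable F.measurableSet)
  obtain ⟨f, hf⟩ := Set.countable_iff_exists_subset_range.1 hcc
  have hp := tendsto_measure_setOf_not μ (A := pattern S ⁻¹' {T})
    (fun m z => ‖w z‖ ≤ m ∧ off z ∈ (Finset.range (m + 1)).image f) (fun m => ?_) ?_ ?_ ?_
  · obtain ⟨m, hm⟩ := (ENNReal.tendsto_nhds_zero.1 hp ε hε).exists
    refine ⟨e, m, (Finset.range (m + 1)).image f,
      {z | ¬(‖w z‖ ≤ m ∧ off z ∈ (Finset.range (m + 1)).image f)}, ?_, hm, ?_⟩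
    · exact (hpm m _).compl
    · intro z _ hz
      have hz' : ‖w z‖ ≤ m ∧ off z ∈ (Finset.range (m + 1)).image f := not_not.1 hz
      exact ⟨w z, hz'.1, off z, hz'.2, hdec z⟩
  · exact hpm m _
  · intro m m' z hmm h
    refine ⟨h.1.trans (by exact_mod_cast hmm), ?_⟩
    exact Finset.image_subset_image (Finset.range_subset_range.2 (by omega)) h.2
  · exact (measurable_pattern fun j => (hS j).measurableSet) (measurableSet_singleton T)
  · intro z hz
    obtain ⟨i, hi⟩ := hf (hoff z hz)
    obtain ⟨m, hm⟩ := exists_nat_ge ‖w z‖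
    refine ⟨max m i, hm.trans (by exact_mod_cast le_max_left m i), ?_⟩
    refine Finset.mem_image.2 ⟨i, Finset.mem_range.2 ?_, hi⟩
    have := le_max_right m i
    omega

lemma neg_logb_prod_laplace {q : ℕ} (hq : 1 ≤ q) (x : Fin n → ℝ) :
    -Real.logb 2 (∏ i, (Real.exp (-|x i| - 1) * (1 / q))) =
      n * Real.logb 2 q + ∑ i, (|x i| + 1) / Real.log 2 := by
  have hq0 : (0 : ℝ) < q := by exact_mod_cast hq
  rw [Real.logb_prod _ _ fun i _ => by positivity, ← Finset.sum_neg_distrib]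
  have h : ∀ i, -Real.logb 2 (Real.exp (-|x i| - 1) * (1 / q))
      = Real.logb 2 q + (|x i| + 1) / Real.log 2 := by
    intro i
    rw [Real.logb_mul (Real.exp_pos _).ne' (by positivity), one_div, Real.logb_inv, Real.logb,
      Real.log_exp]
    ring
  simp_rw [h, Finset.sum_add_distrib]
  simp

/-- Upper bound for the entropy of the quantization of a linear image of a vector with independent
nonsingular components. -/
theorem entropy_quantVec_le (ν : κ → Measure ℝ) [∀ j, IsProbabilityMeasure (ν j)]
    {S : κ → Set ℝ} (hS : ∀ j, (S j).Countable) (g : (κ → ℝ) →ₗ[ℝ] (Fin n → ℝ))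
    (hint : ∀ i, Integrable (fun z => g z i) (Measure.pi ν)) {ε : ℝ≥0∞} (hε : 0 < ε) :
    ∃ K : ℝ≥0∞, K ≠ ∞ ∧ ∀ q : ℕ, 1 ≤ q →
      entropy ((Measure.pi ν).map fun z => quantVec q (g z)) ≤
        ENNReal.ofReal (Real.logb 2 q) *
          (∫⁻ z, (Module.finrank ℝ ((coordSubspace (pattern S z)).map g) : ℝ≥0∞) ∂(Measure.pi ν)
            + ε) + K := by
  classical
  have := Fintype.ofFinite (Set κ)
  set P := Measure.pi ν with hP
  set s : Set κ → ℕ := fun T => Module.finrank ℝ ((coordSubspace T).map g) with hs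
  have hSm : ∀ j, MeasurableSet (S j) := fun j => (hS j).measurableSet
  -- Each bad event costs n bits per log₂ q, and there is one for each pattern; n + 1 keeps the
  -- denominator nonzero when n = 0.
  set ε' : ℝ≥0∞ := ε / ((Fintype.card (Set κ) : ℝ≥0∞) * ((n : ℝ≥0∞) + 1)) with hε'
  have hden : (Fintype.card (Set κ) : ℝ≥0∞) * ((n : ℝ≥0∞) + 1) ≠ ∞ :=
    ENNReal.mul_ne_top (ENNReal.natCast_ne_top _)
      (ENNReal.add_ne_top.2 ⟨ENNReal.natCast_ne_top _, ENNReal.one_ne_top⟩)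
  have hε'0 : 0 < ε' := ENNReal.div_pos hε.ne' hden
  choose e R B E hEm hE hcov using fun T => exists_affine_cover P hS g T hε'0
  have hgm : Measurable g := (LinearMap.toContinuousLinearMap g).measurable
  -- The total mass of `Q q` does not depend on q, so the Gibbs inequality adds only a fixed
  -- constant.
  set Q : ℕ → Measure (Fin n → ℝ) := fun q =>
    tailMeasure n q + ∑ T, ∑ b ∈ B T, affineMeasure (e T) (R T) b q with hQ
  have hQfin : ∀ q, IsFiniteMeasure (Q q) := fun q => by
    refine ⟨?_⟩
    simp only [hQ, Measure.coe_add, Pi.add_apply, Measure.coe_finsetSum, Finset.sum_apply]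
    exact ENNReal.add_lt_top.2 ⟨measure_lt_top _ _, ENNReal.sum_lt_top.2 fun T _ =>
      ENNReal.sum_lt_top.2 fun b _ => measure_lt_top _ _⟩
  set QU : ℝ≥0∞ := laplaceMeasure Set.univ ^ n + ∑ T, ∑ b ∈ B T,
    volume (Metric.closedBall (0 : Fin (s T) → ℝ) (R T + 1)) *
      volume (Metric.closedBall (0 : Fin n → ℝ) 2) with hQU
  have hQuniv : ∀ q, Q q Set.univ = QU := fun q => by
    simp only [hQ, hQU, Measure.coe_add, Pi.add_apply, Measure.coe_finsetSum, Finset.sum_apply,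
      tailMeasure_univ, affineMeasure_univ]
  have hQUtop : QU ≠ ∞ := by
    rw [← hQuniv 0]
    exact measure_ne_top _ _
  have hQtail : ∀ q a, tailMeasure n q {a} ≤ Q q {a} := fun q a => by
    simp only [hQ, Measure.coe_add, Pi.add_apply]
    exact le_self_add
  have hQaff : ∀ q a T, ∀ b ∈ B T, affineMeasure (e T) (R T) b q {a} ≤ Q q {a} := by
    intro q a T b hb
    simp only [hQ, Measure.coe_add, Pi.add_apply, Measure.coe_finsetSum, Finset.sum_apply]
    refine le_trans ?_ le_add_self
    refine le_trans ?_ (Finset.single_le_sum (f := fun T => ∑ b ∈ B T,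
      affineMeasure (e T) (R T) b q {a}) (fun _ _ => zero_le) (Finset.mem_univ T))
    exact Finset.single_le_sum (f := fun b => affineMeasure (e T) (R T) b q {a})
      (fun _ _ => zero_le) hb
  set c : Set κ → ℝ := fun T => 2 * (1 / (1 + ‖e T‖)) with hcdef
  have hc : ∀ T, 0 < c T := fun T => by positivity
  set K1 : ℝ≥0∞ := ∑ T, ENNReal.ofReal (-(s T * Real.logb 2 (c T))) with hK1
  have hK1top : K1 ≠ ∞ := ENNReal.sum_ne_top.2 fun T _ => ENNReal.ofReal_ne_top
  set K2 : (κ → ℝ) → ℝ≥0∞ := fun z => ENNReal.ofReal (∑ i, (|g z i| + 1) / Real.log 2) with hK2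
  have hK2int : ∫⁻ z, K2 z ∂P ≠ ∞ := by
    have h : Integrable (fun z => ∑ i, (|g z i| + 1) / Real.log 2) P :=
      integrable_finsetSum _ fun i _ => (((hint i).abs.add (integrable_const _)).div_const _)
    exact h.lintegral_lt_top.ne
  have hK2m : Measurable K2 := by
    have : ∀ i, Measurable fun z => g z i := fun i => (measurable_pi_apply i).comp hgm
    fun_prop
  set Bad : Set (κ → ℝ) := ⋃ T, pattern S ⁻¹' {T} ∩ E T with hBad
  have hBadm : MeasurableSet Bad := MeasurableSet.iUnion fun T =>
    ((measurable_pattern hSm) (measurableSet_singleton T)).inter (hEm T)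
  have hBadP : (n : ℝ≥0∞) * P Bad ≤ ε := by
    calc (n : ℝ≥0∞) * P Bad ≤ (n + 1) * ∑ _T : Set κ, ε' := by
          refine mul_le_mul' le_self_add ?_
          refine (measure_iUnion_le _).trans ?_
          rw [tsum_fintype]
          exact Finset.sum_le_sum fun T _ => hE T
      _ = (Fintype.card (Set κ) * (n + 1)) * ε' := by
          rw [Finset.sum_const, Finset.card_univ, nsmul_eq_mul]
          ring
      _ ≤ ε := ENNReal.mul_div_le
  refine ⟨K1 + ∫⁻ z, K2 z ∂P + QU / ENNReal.ofReal (Real.log 2), ?_, fun q hq => ?_⟩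
  · have hl : ENNReal.ofReal (Real.log 2) ≠ 0 := by simpa using Real.log_pos one_lt_two
    exact ENNReal.add_ne_top.2 ⟨ENNReal.add_ne_top.2 ⟨hK1top, hK2int⟩,
      ENNReal.div_ne_top hQUtop hl⟩
  have hq1 : (1 : ℝ) ≤ q := by exact_mod_cast hq
  have hq0 : (0 : ℝ) < q := by linarith
  have hlog : 0 ≤ Real.logb 2 (q : ℝ) := Real.logb_nonneg one_lt_two hq1
  have hDm : Measurable fun z => quantVec q (g z) := (measurable_quantVec q).comp hgm
  have hR0 : (P.map fun z => quantVec q (g z)) (Set.range (quantVec (n := n) q))ᶜ = 0 := by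
    rw [Measure.map_apply hDm (countable_range_quantVec q).measurableSet.compl]
    convert measure_empty (μ := P)
    ext z; simp
  have htail : ∀ z, ENNReal.ofReal (∏ i, (Real.exp (-|g z i| - 1) * (1 / q)))
      ≤ Q q {quantVec q (g z)} := fun z =>
    (le_tailMeasure_singleton hq (g z)).trans (hQtail q _)
  have hprod : ∀ z, 0 < ∏ i, (Real.exp (-|g z i| - 1) * (1 / (q : ℝ))) := fun z =>
    Finset.prod_pos fun i _ => by positivity
  have hkm : Measurable fun a : Fin n → ℝ => (Q q).real {a} :=
    (measurable_kernel_singleton (Kernel.const Unit (Q q))).comp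
      ((measurable_const (a := ())).prodMk measurable_id)
  have hae : ∀ᵐ a ∂(P.map fun z => quantVec q (g z)), Q q {a} ≠ 0 := by
    have hset : MeasurableSet {a : Fin n → ℝ | Q q {a} ≠ 0} := by
      have : {a : Fin n → ℝ | Q q {a} ≠ 0} = {a : Fin n → ℝ | (Q q).real {a} ≠ 0} := by
        ext a
        simp [measureReal_eq_zero_iff]
      rw [this]
      exact hkm (measurableSet_singleton 0).compl
    rw [ae_map_iff hDm.aemeasurable hset]
    exact ae_of_all _ fun z => ((ENNReal.ofReal_pos.2 (hprod z)).trans_le (htail z)).ne'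
  -- On the bad set the tail part of `Q` costs n log₂ q plus an integrable term; elsewhere an affine
  -- part costs s(T) log₂ q plus a constant.
  have hpt : ∀ z, info ((Q q).real {quantVec q (g z)}) ≤
      (ENNReal.ofReal (Real.logb 2 q) * (s (pattern S z) + Bad.indicator (fun _ => (n : ℝ≥0∞)) z)
        + K2 z) + K1 := by
    intro z
    by_cases hz : z ∈ Bad
    · refine (info_le_of_le (hprod z) (htail z)).trans ?_
      rw [neg_logb_prod_laplace hq, Set.indicator_of_mem hz]
      refine ENNReal.ofReal_add_le.trans ?_
      rw [ENNReal.ofReal_mul (Nat.cast_nonneg n), ENNReal.ofReal_natCast, mul_comm]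
      refine le_trans (add_le_add ?_ le_rfl) le_self_add
      gcongr
      exact le_add_self
    · obtain ⟨v, hv, b, hb, hgz⟩ := hcov (pattern S z) z rfl
        fun hzE => hz (Set.mem_iUnion.2 ⟨pattern S z, rfl, hzE⟩)
      have h1 := (le_affineMeasure_singleton (e (pattern S z)) b hq hv).trans
        (hQaff q _ (pattern S z) b hb)
      rw [← hgz] at h1
      refine (info_le_of_le (pow_pos (div_pos (hc _) hq0) _) h1).trans ?_
      rw [Real.logb_pow, Real.logb_div (hc _).ne' hq0.ne']
      have h2 : -((s (pattern S z) : ℝ) * (Real.logb 2 (c (pattern S z)) - Real.logb 2 q))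
          = Real.logb 2 q * s (pattern S z)
            + -(s (pattern S z) * Real.logb 2 (c (pattern S z))) := by ring
      refine (ENNReal.ofReal_le_ofReal h2.le).trans (ENNReal.ofReal_add_le.trans ?_)
      refine add_le_add ?_ ?_
      · rw [ENNReal.ofReal_mul hlog, ENNReal.ofReal_natCast]
        refine le_trans ?_ le_self_add
        gcongr
        exact le_self_add
      · exact Finset.single_le_sum (f := fun T => ENNReal.ofReal (-(s T * Real.logb 2 (c T))))
          (fun _ _ => zero_le) (Finset.mem_univ _)
  have hsm : Measurable fun z => ((s (pattern S z) : ℕ) : ℝ≥0∞) :=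
    (measurable_of_countable fun T => ((s T : ℕ) : ℝ≥0∞)).comp (measurable_pattern hSm)
  have hindm : Measurable (Bad.indicator fun _ => (n : ℝ≥0∞)) := measurable_const.indicator hBadm
  calc entropy (P.map fun z => quantVec q (g z))
      ≤ ∫⁻ z, info ((Q q).real {quantVec q (g z)}) ∂P + QU / ENNReal.ofReal (Real.log 2) := by
        have h := entropy_le_lintegral_info (P.map fun z => quantVec q (g z)) (Q q)
          (countable_range_quantVec q) hR0 hae
        rwa [lintegral_map (f := fun a => info ((Q q).real {a})) (measurable_info.comp hkm) hDm,
          hQuniv] at h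
    _ ≤ (ENNReal.ofReal (Real.logb 2 q) * (∫⁻ z, (s (pattern S z) : ℝ≥0∞) ∂P + n * P Bad)
          + ∫⁻ z, K2 z ∂P + K1) + QU / ENNReal.ofReal (Real.log 2) := by
        gcongr
        refine (lintegral_mono hpt).trans ?_
        rw [lintegral_add_right _ measurable_const, lintegral_add_right _ hK2m,
          lintegral_const_mul (f := fun z => ((s (pattern S z) : ℕ) : ℝ≥0∞)
            + Bad.indicator (fun _ => (n : ℝ≥0∞)) z) _ (hsm.add hindm), lintegral_add_left hsm,
          lintegral_indicator_const hBadm, lintegral_const, measure_univ, mul_one]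
    _ ≤ (ENNReal.ofReal (Real.logb 2 q) * (∫⁻ z, (s (pattern S z) : ℝ≥0∞) ∂P + ε)
          + ∫⁻ z, K2 z ∂P + K1) + QU / ENNReal.ofReal (Real.log 2) := by
        gcongr
    _ = _ := by ring

end UpperBound

lemma IsNonsingular.exists_countable {μ : Measure ℝ} (h : IsNonsingular μ) :
    ∃ S : Set ℝ, S.Countable ∧ μ.restrict Sᶜ ≪ volume := by
  obtain ⟨μd, μc, rfl, ⟨S, hS, h0⟩, hac⟩ := h
  refine ⟨S, hS, ?_⟩
  rw [Measure.restrict_add, Measure.restrict_eq_zero.2 h0, zero_add]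
  exact Measure.restrict_le_self.absolutelyContinuous.trans hac

/-! ### The information dimension of a linear image. -/

section Dimension

variable {κ : Type*} [Fintype κ] {β : Type*} [MeasurableSpace β]
  {α : Type*} [MeasurableSpace α]

-- A linear section of `h` over the image of the coordinate subspace lifts `V` to directions
-- supported in `T`. The separation constant is the norm of the coordinate isomorphism of `V`.
omit [MeasurableSpace β] [MeasurableSpace α] in
lemma exists_isResolved {E : Type*} [NormedAddCommGroup E] [NormedSpace ℝ E]
    [FiniteDimensional ℝ E] {D : ℕ → (κ → ℝ) → α} {W : (κ → ℝ) → β} {T : Set κ}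
    (h : (κ → ℝ) →ₗ[ℝ] E) (V : Submodule ℝ E) (hV : V ≤ (coordSubspace T).map h)
    (hinv : ∀ z u, h u ∈ V → W (z + u) = W z)
    (hsep : ∀ q : ℕ, 1 ≤ q → ∀ z z', h (z - z') ∈ V → D q z = D q z' → ‖h (z - z')‖ ≤ 1 / q) :
    ∃ G : (Fin (Module.finrank ℝ V) → ℝ) →ₗ[ℝ] (κ → ℝ), IsResolved D W T G := by
  obtain ⟨σ, hσ⟩ := LinearMap.exists_rightInverse_of_surjective (h.submoduleMap (coordSubspace T))
    (LinearMap.range_eq_top.2 (LinearMap.submoduleMap_surjective _ _))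
  let φ : (Fin (Module.finrank ℝ V) → ℝ) ≃ₗ[ℝ] V := LinearEquiv.ofFinrankEq _ _ (by simp)
  let G : (Fin (Module.finrank ℝ V) → ℝ) →ₗ[ℝ] (κ → ℝ) :=
    (coordSubspace T).subtype ∘ₗ σ ∘ₗ Submodule.inclusion hV ∘ₗ φ.toLinearMap
  have hG : ∀ v, h (G v) = φ v := fun v => by
    have h1 := congrArg Subtype.val
      (LinearMap.congr_fun hσ (Submodule.inclusion hV (φ v)))
    exact h1
  refine ⟨G, fun v => (σ (Submodule.inclusion hV (φ v))).2, fun z v => hinv z _ ?_, ?_⟩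
  · rw [hG]; exact (φ v).2
  · let ψ : V →L[ℝ] (Fin (Module.finrank ℝ V) → ℝ) :=
      LinearMap.toContinuousLinearMap φ.symm.toLinearMap
    refine ⟨‖ψ‖, fun q hq z v v' hD => ?_⟩
    have h1 : z + G v - (z + G v') = G (v - v') := by rw [map_sub]; abel
    have h2 := hsep q hq _ _ (by rw [h1, hG]; exact (φ _).2) hD
    rw [h1, hG] at h2
    have h3 : v - v' = ψ (φ (v - v')) := (φ.symm_apply_apply _).symm
    rw [h3, div_eq_mul_one_div]
    exact (ψ.le_opNorm _).trans (mul_le_mul_of_nonneg_left h2 (norm_nonneg _))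

lemma tendsto_ofReal_logb : Tendsto (fun q : ℕ => ENNReal.ofReal (Real.logb 2 (q : ℝ))) atTop
    (𝓝 ∞) :=
  ENNReal.tendsto_ofReal_atTop.comp
    ((Real.tendsto_logb_atTop one_lt_two).comp tendsto_natCast_atTop_atTop)

lemma tendsto_div_ofReal_logb {c : ℝ≥0∞} (hc : c ≠ ∞) :
    Tendsto (fun q : ℕ => c / ENNReal.ofReal (Real.logb 2 (q : ℝ))) atTop (𝓝 0) := by
  have h := ENNReal.Tendsto.const_div tendsto_ofReal_logb (a := c) (Or.inr hc)
  rwa [ENNReal.div_top] at h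

lemma eventually_ofReal_logb_ne_zero :
    ∀ᶠ q : ℕ in atTop, ENNReal.ofReal (Real.logb 2 (q : ℝ)) ≠ 0 := by
  filter_upwards [eventually_ge_atTop 2] with q hq
  simpa using Real.logb_pos one_lt_two (by exact_mod_cast hq)

variable {n : ℕ} (ν : κ → Measure ℝ) [∀ j, IsProbabilityMeasure (ν j)]
    {S : κ → Set ℝ} (hS : ∀ j, (S j).Countable) (g : (κ → ℝ) →ₗ[ℝ] (Fin n → ℝ))
    (hint : ∀ i, Integrable (fun z => g z i) (Measure.pi ν))

-- Finiteness is what later permits subtracting entropies and clearing them from denominators in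
-- `ℝ≥0∞`.
include hS hint in
lemma entropy_quantVec_ne_top {q : ℕ} (hq : 1 ≤ q) :
    entropy ((Measure.pi ν).map fun z => quantVec q (g z)) ≠ ∞ := by
  obtain ⟨K, hK, h⟩ := entropy_quantVec_le ν hS g hint one_pos
  have := Fintype.ofFinite (Set κ)
  have hfin : ∫⁻ z, (Module.finrank ℝ ((coordSubspace (pattern S z)).map g) : ℝ≥0∞)
      ∂(Measure.pi ν) ≠ ∞ := by
    refine ((lintegral_mono (g := fun _ => (n : ℝ≥0∞)) fun z => ?_).trans_lt ?_).ne
    · have := Submodule.finrank_le ((coordSubspace (pattern S z)).map g)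
      rw [Module.finrank_fin_fun] at this
      exact Nat.cast_le.2 this
    · simp
  refine ((h q hq).trans_lt (ENNReal.add_lt_top.2 ⟨ENNReal.mul_lt_top ENNReal.ofReal_lt_top
    (ENNReal.add_lt_top.2 ⟨hfin.lt_top, ENNReal.one_lt_top⟩), hK.lt_top⟩)).ne

include hS hint in
/-- The information dimension of a linear image of a vector with independent nonsingular
components. -/
theorem tendsto_entropy_quantVec (hν : ∀ j, (ν j).restrict (S j)ᶜ ≪ volume) :
    Tendsto (fun q : ℕ => entropy ((Measure.pi ν).map fun z => quantVec q (g z))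
      / ENNReal.ofReal (Real.logb 2 (q : ℝ))) atTop
      (𝓝 (∫⁻ z, (Module.finrank ℝ ((coordSubspace (pattern S z)).map g) : ℝ≥0∞)
        ∂(Measure.pi ν))) := by
  have hgm : Measurable g := (LinearMap.toContinuousLinearMap g).measurable
  refine tendsto_of_le_liminf_of_limsup_le ?_ ?_
  · have hres : ∀ T, ∃ G : (Fin (Module.finrank ℝ ((coordSubspace T).map g)) → ℝ) →ₗ[ℝ] (κ → ℝ),
        IsResolved (fun q z => quantVec q (g z)) (fun _ => ()) T G := fun T => by
      refine exists_isResolved g _ le_rfl (fun _ _ _ => rfl) fun q hq z z' _ hD => ?_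
      rw [pi_norm_le_iff_of_nonneg (by positivity)]
      intro i
      rw [map_sub]
      exact abs_sub_le_of_quant_eq hq (congrFun hD i)
    choose G hG using hres
    have h := lintegral_le_liminf_condEntropy ν (fun j => (hS j).measurableSet) hν
      (fun q => (measurable_quantVec q).comp hgm) (W := fun _ => ()) measurable_const
      (fun q => ⟨_, countable_range_quantVec q, fun z => ⟨_, rfl⟩⟩) _ G hG
    refine h.trans (liminf_le_liminf (Eventually.of_forall fun q => ?_))
    exact (congrArg (· / _) (condEntropy_const (Measure.pi ν)
      ((measurable_quantVec q).comp hgm))).le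
  · refine ENNReal.le_of_forall_pos_le_add fun ε hε _ => ?_
    obtain ⟨K, hK, h⟩ := entropy_quantVec_le ν hS g hint (ENNReal.coe_pos.2 hε)
    have hlim := (tendsto_const_nhds (x := ∫⁻ z,
      (Module.finrank ℝ ((coordSubspace (pattern S z)).map g) : ℝ≥0∞) ∂(Measure.pi ν) + ε)
        (f := atTop)).add (tendsto_div_ofReal_logb hK)
    rw [add_zero] at hlim
    rw [← hlim.limsup_eq]
    refine limsup_le_limsup ?_
    filter_upwards [eventually_ge_atTop 1, eventually_ofReal_logb_ne_zero] with q hq hL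
    refine (ENNReal.div_le_div_right (h q hq) _).trans ?_
    rw [ENNReal.add_div, mul_comm, ENNReal.mul_div_cancel_right hL ENNReal.ofReal_ne_top]

end Dimension

/-! ### Rank–nullity on subspaces, and dimensions of products. -/

section LinearAlgebra

lemma finrank_map_add_finrank_inf_ker {E F : Type*} [AddCommGroup E] [Module ℝ E]
    [FiniteDimensional ℝ E] [AddCommGroup F] [Module ℝ F] (V : Submodule ℝ E) (f : E →ₗ[ℝ] F) :
    Module.finrank ℝ (V.map f) + Module.finrank ℝ (V ⊓ LinearMap.ker f : Submodule ℝ E)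
      = Module.finrank ℝ V := by
  have h := LinearMap.finrank_range_add_finrank_ker (f.domRestrict V)
  rw [LinearMap.range_domRestrict] at h
  rw [← h]
  congr 1
  have h1 : (LinearMap.ker (f.domRestrict V)).map V.subtype = V ⊓ LinearMap.ker f := by
    ext x
    simp only [Submodule.mem_map, LinearMap.mem_ker, Submodule.mem_inf, Submodule.subtype_apply,
      LinearMap.domRestrict_apply]
    constructor
    · rintro ⟨y, hy, rfl⟩
      exact ⟨y.2, hy⟩
    · rintro ⟨hx, hf⟩
      exact ⟨⟨x, hx⟩, hf, rfl⟩
  rw [← h1]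
  exact (Submodule.equivMapOfInjective _ V.injective_subtype _).finrank_eq.symm

lemma finrank_submodule_pi {N : ℕ} {E : Type*} [AddCommGroup E] [Module ℝ E]
    [FiniteDimensional ℝ E] (V : Fin N → Submodule ℝ E) :
    Module.finrank ℝ (Submodule.pi Set.univ V) = ∑ i, Module.finrank ℝ (V i) := by
  let φ : (Submodule.pi Set.univ V) ≃ₗ[ℝ] (∀ i, V i) :=
    { toFun := fun u i => ⟨u.1 i, u.2 i trivial⟩
      map_add' := fun _ _ => rfl
      map_smul' := fun _ _ => rfl
      invFun := fun u => ⟨fun i => u i, fun i _ => (u i).2⟩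
      left_inv := fun _ => rfl
      right_inv := fun _ => rfl }
  rw [φ.finrank_eq, Module.finrank_pi_fintype]

end LinearAlgebra

lemma entropy_map_comp_of_injective {Ω α γ : Type*} [MeasurableSpace Ω] [MeasurableSpace α]
    [MeasurableSpace γ] [MeasurableSingletonClass α] [MeasurableSingletonClass γ] (P : Measure Ω)
    [IsFiniteMeasure P] {D : Ω → α} (hD : Measurable D) {R : Set α} (hR : R.Countable)
    (hDR : ∀ ω, D ω ∈ R) {f : α → γ} (hf : Measurable f) (hinj : Function.Injective f) :
    entropy (P.map fun ω => f (D ω)) = entropy (P.map D) := by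
  rw [entropy_map_eq_lintegral P (D := fun ω => f (D ω)) (hf.comp hD) (hR.image f) fun ω => ⟨_, hDR ω, rfl⟩,
    entropy_map_eq_lintegral P hD hR hDR]
  refine lintegral_congr fun ω => ?_
  congr 2
  ext x
  exact hinj.eq_iff

/-! ### Information dimensions of a pair and of one component given the other. -/

section Pair

variable {Ω : Type*} [MeasurableSpace Ω] {P : Measure Ω} [IsProbabilityMeasure P]

/-- The coordinate `i` of a vector, as a vector of length one. -/
def coordLin (i : Fin 2) : (Fin 2 → ℝ) →ₗ[ℝ] (Fin 1 → ℝ) := LinearMap.pi fun _ => LinearMap.proj i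

lemma coordLin_apply (i : Fin 2) (v : Fin 2 → ℝ) : coordLin i v = ![v i] := by
  ext j
  fin_cases j
  rfl

lemma coordLin_eq_zero {i : Fin 2} {v : Fin 2 → ℝ} : coordLin i v = 0 ↔ v i = 0 := by
  rw [coordLin_apply, funext_iff]
  simp

/-- A representation of the law of a random pair as the law of a linear image of a vector with
independent nonsingular components. -/
structure PairModel (P : Measure Ω) (Z : Ω → Fin 2 → ℝ) {k : ℕ} (A : (Fin k → ℝ) →ₗ[ℝ] (Fin 2 → ℝ))
    (ν : Fin k → Measure ℝ) (S : Fin k → Set ℝ) : Prop where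
  measurable : Measurable Z
  isProbabilityMeasure : ∀ j, IsProbabilityMeasure (ν j)
  countable : ∀ j, (S j).Countable
  absolutelyContinuous : ∀ j, (ν j).restrict (S j)ᶜ ≪ volume
  map_eq : P.map Z = (Measure.pi ν).map A
  integrable : ∀ i, Integrable (fun ω => Z ω i) P

variable {Z : Ω → Fin 2 → ℝ} {k : ℕ} {A : (Fin k → ℝ) →ₗ[ℝ] (Fin 2 → ℝ)}
  {ν : Fin k → Measure ℝ} {S : Fin k → Set ℝ}

lemma measurable_linearMap {κ E : Type*} [Fintype κ] [NormedAddCommGroup E] [NormedSpace ℝ E]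
    [MeasurableSpace E] [BorelSpace E] (g : (κ → ℝ) →ₗ[ℝ] E) : Measurable g :=
  (LinearMap.continuous_of_finiteDimensional g).measurable

/-- The mean dimension of a subspace that depends on the pattern of a vector with law `Measure.pi ν`. -/
def meanDim (ν : Fin k → Measure ℝ) (S : Fin k → Set ℝ)
    (U : Set (Fin k) → Submodule ℝ (Fin 2 → ℝ)) : ℝ≥0∞ :=
  ∫⁻ z, (Module.finrank ℝ (U (pattern S z)) : ℝ≥0∞) ∂(Measure.pi ν)

omit [IsProbabilityMeasure P] in
lemma meanDim_ne_top (hM : PairModel P Z A ν S) (U : Set (Fin k) → Submodule ℝ (Fin 2 → ℝ)) :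
    meanDim ν S U ≠ ∞ := by
  have := hM.isProbabilityMeasure
  refine ((lintegral_mono (g := fun _ => (2 : ℝ≥0∞)) fun z => ?_).trans_lt ?_).ne
  · have := Submodule.finrank_le (U (pattern S z))
    rw [Module.finrank_fin_fun] at this
    exact (Nat.cast_le.2 this).trans (by simp)
  · simp

/-- The image of the coordinate subspace of a pattern. -/
def imageSpace (A : (Fin k → ℝ) →ₗ[ℝ] (Fin 2 → ℝ)) (T : Set (Fin k)) : Submodule ℝ (Fin 2 → ℝ) :=
  (coordSubspace T).map A

omit [IsProbabilityMeasure P] in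
lemma PairModel.integrable_pi (hM : PairModel P Z A ν S) (i : Fin 2) :
    Integrable (fun z => A z i) (Measure.pi ν) := by
  have h1 : Integrable (fun v : Fin 2 → ℝ => v i) (P.map Z) :=
    (integrable_map_measure (measurable_pi_apply i).aestronglyMeasurable
      hM.measurable.aemeasurable).2 (hM.integrable i)
  rw [hM.map_eq] at h1
  exact (integrable_map_measure (measurable_pi_apply i).aestronglyMeasurable
    (measurable_linearMap A).aemeasurable).1 h1

omit [IsProbabilityMeasure P] in
lemma PairModel.map_comp (hM : PairModel P Z A ν S) {γ : Type*} [MeasurableSpace γ]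
    {f : (Fin 2 → ℝ) → γ} (hf : Measurable f) :
    P.map (fun ω => f (Z ω)) = (Measure.pi ν).map fun z => f (A z) := by
  have h1 := Measure.map_map hf hM.measurable (μ := P)
  rw [hM.map_eq, Measure.map_map hf (measurable_linearMap A)] at h1
  exact h1.symm

omit [IsProbabilityMeasure P] in
lemma PairModel.tendsto_entropy (hM : PairModel P Z A ν S) :
    Tendsto (fun q : ℕ => entropy (P.map fun ω => quantVec q (Z ω))
      / ENNReal.ofReal (Real.logb 2 (q : ℝ))) atTop (𝓝 (meanDim ν S (imageSpace A))) := by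
  have := hM.isProbabilityMeasure
  have h := tendsto_entropy_quantVec ν hM.countable A hM.integrable_pi hM.absolutelyContinuous
  refine h.congr fun q => ?_
  rw [hM.map_comp (f := quantVec q) (measurable_quantVec q)]

omit [IsProbabilityMeasure P] in
lemma PairModel.entropy_ne_top (hM : PairModel P Z A ν S) {q : ℕ} (hq : 1 ≤ q) :
    entropy (P.map fun ω => quantVec q (Z ω)) ≠ ∞ := by
  have := hM.isProbabilityMeasure
  rw [hM.map_comp (f := quantVec q) (measurable_quantVec q)]
  exact entropy_quantVec_ne_top ν hM.countable A hM.integrable_pi hq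

/-- The conditional information dimension of one component of a pair given the other one. -/
lemma PairModel.tendsto_condEntropy (hM : PairModel P Z A ν S) {i j : Fin 2} (hij : i ≠ j) :
    Tendsto (fun q : ℕ => condEntropy P (fun ω => quantVec q ![Z ω i]) (fun ω => Z ω j)
      / ENNReal.ofReal (Real.logb 2 (q : ℝ))) atTop
      (𝓝 (meanDim ν S fun T => imageSpace A T ⊓ LinearMap.ker (coordLin j))) := by
  have := hM.isProbabilityMeasure
  have hAm := measurable_linearMap A
  have hZ := hM.measurable
  have hall : ∀ v : Fin 2 → ℝ, v i = 0 → v j = 0 → v = 0 := by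
    intro v hi hj
    ext l
    fin_cases i <;> fin_cases j <;> fin_cases l <;> simp_all
  have hvec : ∀ (q : ℕ) (l : Fin 2), Measurable fun v : Fin 2 → ℝ => quantVec q ![v l] :=
    fun q l => (measurable_quantVec q).comp (measurable_pi_lambda _ fun s => by
      fin_cases s; exact measurable_pi_apply l)
  refine tendsto_of_le_liminf_of_limsup_le ?_ ?_
  -- Directions with vanishing `j`-th component leave the condition fixed, and quantizing the `i`-th
  -- component alone separates them.
  · have hres : ∀ T, ∃ G : (Fin (Module.finrank ℝ (imageSpace A T ⊓ LinearMap.ker (coordLin j) :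
        Submodule ℝ (Fin 2 → ℝ))) → ℝ) →ₗ[ℝ] (Fin k → ℝ),
        IsResolved (fun q z => quantVec q ![A z i]) (fun z => A z j) T G := fun T => by
      refine exists_isResolved A _ inf_le_left (fun z u hu => ?_) fun q hq z z' hz hD => ?_
      · have h1 : A u j = 0 := coordLin_eq_zero.1 hu.2
        rw [map_add, Pi.add_apply, h1, add_zero]
      · have h1 : A (z - z') j = 0 := coordLin_eq_zero.1 hz.2
        rw [pi_norm_le_iff_of_nonneg (by positivity)]
        intro l
        by_cases hl : l = j
        · rw [hl, h1, norm_zero]; positivity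
        · have hli : l = i := by
            fin_cases i <;> fin_cases j <;> fin_cases l <;> simp_all
          rw [hli, map_sub]
          exact abs_sub_le_of_quant_eq hq (congrFun hD 0)
    choose G hG using hres
    have h := lintegral_le_liminf_condEntropy ν (fun j => (hM.countable j).measurableSet)
      hM.absolutelyContinuous (fun q => (hvec q i).comp hAm) (W := fun z => A z j)
      ((measurable_pi_apply j).comp hAm)
      (fun q => ⟨_, countable_range_quantVec q, fun z => ⟨_, rfl⟩⟩) _ G hG
    refine h.trans (liminf_le_liminf (Eventually.of_forall fun q => ?_))
    refine (congrArg (· / _) (condEntropy_congr (Measure.pi ν) P ((hvec q i).comp hAm)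
      ((hvec q i).comp hZ) ?_)).le
    exact (hM.map_comp (f := fun v => (v j, quantVec q ![v i]))
      ((measurable_pi_apply j).prodMk (hvec q i))).symm
  -- Replacing the condition by its quantization costs a constant; by the chain rule the resulting
  -- conditional entropy is the joint entropy minus that of the `j`-th component.
  · have hY := tendsto_entropy_quantVec ν hM.countable (coordLin j ∘ₗ A)
      (fun _ => hM.integrable_pi j) hM.absolutelyContinuous
    have hYeq : ∀ q : ℕ, entropy ((Measure.pi ν).map fun z => quantVec q ((coordLin j ∘ₗ A) z))
        = entropy (P.map fun ω => quantVec q ![Z ω j]) := fun q => by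
      rw [hM.map_comp (hvec q j)]
      simp only [LinearMap.comp_apply, coordLin_apply]
    simp only [hYeq] at hY
    have hYtop : ∀ q : ℕ, 1 ≤ q → entropy (P.map fun ω => quantVec q ![Z ω j]) ≠ ∞ :=
      fun q hq => by
        rw [← hYeq]
        exact entropy_quantVec_ne_top ν hM.countable (coordLin j ∘ₗ A)
          (fun _ => hM.integrable_pi j) hq
    -- Rank–nullity for `coordLin j`, averaged over the pattern. The summand 0 is the limit of the
    -- constant divided by log₂ q.
    have hsplit : meanDim ν S (fun T => imageSpace A T ⊓ LinearMap.ker (coordLin j))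
        = meanDim ν S (imageSpace A) + 0 - ∫⁻ z, (Module.finrank ℝ
          ((coordSubspace (pattern S z)).map (coordLin j ∘ₗ A)) : ℝ≥0∞) ∂(Measure.pi ν) := by
      have h1 : meanDim ν S (imageSpace A) = ∫⁻ z, (Module.finrank ℝ
          ((coordSubspace (pattern S z)).map (coordLin j ∘ₗ A)) : ℝ≥0∞) ∂(Measure.pi ν)
          + meanDim ν S (fun T => imageSpace A T ⊓ LinearMap.ker (coordLin j)) := by
        unfold meanDim
        rw [← lintegral_add_left]
        · refine lintegral_congr fun z => ?_
          rw [Submodule.map_comp, ← Nat.cast_add, ← finrank_map_add_finrank_inf_ker _ (coordLin j)]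
          rfl
        · exact (measurable_of_countable fun T => ((Module.finrank ℝ
            ((coordSubspace T).map (coordLin j ∘ₗ A)) : ℕ) : ℝ≥0∞)).comp
            (measurable_pattern fun j => (hM.countable j).measurableSet)
      have h2 : ∫⁻ z, (Module.finrank ℝ ((coordSubspace (pattern S z)).map (coordLin j ∘ₗ A)) :
          ℝ≥0∞) ∂(Measure.pi ν) ≠ ∞ :=
        ne_top_of_le_ne_top (meanDim_ne_top hM (imageSpace A)) (h1 ▸ le_self_add)
      rw [add_zero, h1, ENNReal.add_sub_cancel_left h2]
    have hc : (1 : ℝ≥0∞) / ENNReal.ofReal (Real.log 2) ≠ ∞ :=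
      ENNReal.div_ne_top ENNReal.one_ne_top (by simpa using Real.log_pos one_lt_two)
    have hlim := ENNReal.Tendsto.sub (hM.tendsto_entropy.add (tendsto_div_ofReal_logb hc)) hY
      (Or.inl (by rw [add_zero]; exact meanDim_ne_top hM _))
    rw [← hsplit] at hlim
    rw [← hlim.limsup_eq]
    refine limsup_le_limsup ?_
    filter_upwards [eventually_ge_atTop 1, eventually_ofReal_logb_ne_zero] with q hq hL
    refine ENNReal.le_sub_of_add_le_right (ENNReal.div_ne_top (hYtop q hq) hL) ?_
    rw [← ENNReal.add_div, ← ENNReal.add_div]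
    refine ENNReal.div_le_div_right ?_ _
    have hcR := countable_range_quantVec (n := 1) q
    have hvec1 : Measurable fun y : ℝ => quantVec q ![y] :=
      (measurable_quantVec q).comp (measurable_pi_lambda _ fun s => by
        fin_cases s; exact measurable_id)
    have h1 := condEntropy_le_condEntropy_comp P (D := fun ω => quantVec q ![Z ω i])
      (W := fun ω => Z ω j) ((hvec q i).comp hZ) ((measurable_pi_apply j).comp hZ) hcR
      (fun ω => ⟨_, rfl⟩) (f := fun y => quantVec q ![y]) hvec1
    have h2 := condEntropy_add_entropy P (D := fun ω => quantVec q ![Z ω i])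
      (W := fun ω => quantVec q ![Z ω j]) ((hvec q i).comp hZ) ((hvec q j).comp hZ) hcR
      (fun ω => ⟨_, rfl⟩) hcR (fun ω => ⟨_, rfl⟩)
    have h3 := entropy_map_comp_of_injective P (D := fun ω => quantVec q (Z ω))
      ((measurable_quantVec q).comp hZ) (countable_range_quantVec q) (fun ω => ⟨_, rfl⟩)
      (f := fun v => (coordLin i v, coordLin j v))
      ((measurable_linearMap _).prodMk (measurable_linearMap _)) (by
        intro v w hvw
        simp only [Prod.mk.injEq, coordLin_apply] at hvw
        have hi : v i = w i := congrFun hvw.1 0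
        have hj : v j = w j := congrFun hvw.2 0
        refine sub_eq_zero.1 (hall _ ?_ ?_) <;> simp [hi, hj])
    have h4 : (fun ω => (coordLin i (quantVec q (Z ω)), coordLin j (quantVec q (Z ω))))
        = fun ω => (quantVec q ![Z ω i], quantVec q ![Z ω j]) := by
      funext ω
      have h5 : ∀ l, coordLin l (quantVec q (Z ω)) = quantVec q ![Z ω l] := fun l => by
        funext s
        fin_cases s
        rfl
      rw [h5, h5]
    simp only [h4] at h3
    rw [measure_univ] at h1
    calc _ ≤ condEntropy P (fun ω => quantVec q ![Z ω i]) (fun ω => quantVec q ![Z ω j])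
          + 1 / ENNReal.ofReal (Real.log 2) + entropy (P.map fun ω => quantVec q ![Z ω j]) :=
          add_le_add h1 le_rfl
      _ = _ := by rw [add_right_comm, h2, h3]

end Pair

/-! ### Blocks of independent copies of the linear model. -/

section Block

variable {k N : ℕ}

/-- The blockwise action of a linear map on a vector of blocks. -/
def blockLin (A : (Fin k → ℝ) →ₗ[ℝ] (Fin 2 → ℝ)) (N : ℕ) :
    (Fin N × Fin k → ℝ) →ₗ[ℝ] (Fin N → Fin 2 → ℝ) where
  toFun z i := A fun j => z (i, j)
  map_add' z w := by
    funext i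
    exact A.map_add (fun j => z (i, j)) (fun j => w (i, j))
  map_smul' c z := by
    funext i
    exact A.map_smul c (fun j => z (i, j))

/-- Different blocks involve disjoint coordinates, so preimages can be chosen block by block. -/
lemma pi_le_map_blockLin (A : (Fin k → ℝ) →ₗ[ℝ] (Fin 2 → ℝ)) (T : Set (Fin N × Fin k))
    (U : Fin N → Submodule ℝ (Fin 2 → ℝ)) (hU : ∀ i, U i ≤ imageSpace A {j | (i, j) ∈ T}) :
    Submodule.pi Set.univ U ≤ (coordSubspace T).map (blockLin A N) := by
  intro u hu
  choose z hz hzu using fun i => Submodule.mem_map.1 (hU i (hu i trivial))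
  exact Submodule.mem_map.2 ⟨fun p => z p.1 p.2, fun p hp => hz p.1 p.2 hp, funext hzu⟩

variable (ν : Fin k → Measure ℝ) [∀ j, IsProbabilityMeasure (ν j)]

lemma map_curry_pi : (Measure.pi fun p : Fin N × Fin k => ν p.2).map (fun z i j => z (i, j))
    = Measure.pi fun _ : Fin N => Measure.pi ν := by
  have h := Measure.infinitePi_map_curry (ι := Fin N) (κ := Fin k) fun _ => ν
  simp only [Measure.infinitePi_eq_pi] at h
  exact h

lemma map_blockLin_pi (A : (Fin k → ℝ) →ₗ[ℝ] (Fin 2 → ℝ)) :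
    (Measure.pi fun p : Fin N × Fin k => ν p.2).map (blockLin A N)
      = Measure.pi fun _ : Fin N => (Measure.pi ν).map A := by
  have hA := measurable_linearMap A
  have : IsProbabilityMeasure ((Measure.pi ν).map A) :=
    Measure.isProbabilityMeasure_map hA.aemeasurable
  rw [← Measure.pi_map_pi (fun _ => hA.aemeasurable), ← map_curry_pi,
    Measure.map_map (by fun_prop) (by fun_prop)]
  rfl

lemma lintegral_sum_blocks (f : (Fin k → ℝ) → ℝ≥0∞) (hf : Measurable f) :
    ∫⁻ z, ∑ i : Fin N, f (fun j => z (i, j)) ∂(Measure.pi fun p : Fin N × Fin k => ν p.2)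
      = N * ∫⁻ z, f z ∂(Measure.pi ν) := by
  have hm : ∀ i : Fin N, Measurable fun z : Fin N × Fin k → ℝ => fun j => z (i, j) :=
    fun i => by fun_prop
  rw [lintegral_finsetSum (f := fun (i : Fin N) (z : Fin N × Fin k → ℝ) => f fun j => z (i, j)) _
    fun i _ => hf.comp (hm i)]
  have h : ∀ i : Fin N, ∫⁻ z, f (fun j => z (i, j)) ∂(Measure.pi fun p : Fin N × Fin k => ν p.2)
      = ∫⁻ z, f z ∂(Measure.pi ν) := fun i => by
    rw [← lintegral_map hf (hm i)]
    congr 1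
    have h1 := (measurePreserving_eval (fun _ : Fin N => Measure.pi ν) i).map_eq
    rw [← map_curry_pi, Measure.map_map (by fun_prop) (by fun_prop)] at h1
    exact h1
  simp [h]

end Block

/-! ### Blocks of the source and their linear measurements. -/

section Source

variable {Ω : Type*} [MeasurableSpace Ω] {P : Measure Ω} [IsProbabilityMeasure P]
  {X Y : ℕ → Ω → ℝ} {k : ℕ} {A : (Fin k → ℝ) →ₗ[ℝ] (Fin 2 → ℝ)}
  {ν : Fin k → Measure ℝ} {S : Fin k → Set ℝ}

omit [IsProbabilityMeasure P] in
lemma IsMemorylessSource.measurable_pair (h : IsMemorylessSource P X Y) (i : ℕ) :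
    Measurable fun ω => ![X i ω, Y i ω] := by
  refine measurable_pi_lambda _ fun j => ?_
  fin_cases j
  · exact h.measurable_fst i
  · exact h.measurable_snd i

lemma measurable_vecPair : Measurable fun p : ℝ × ℝ => ![p.1, p.2] := by
  refine measurable_pi_lambda _ fun j => ?_
  fin_cases j
  · exact measurable_fst
  · exact measurable_snd

omit [IsProbabilityMeasure P] in
lemma IsMemorylessSource.iIndepFun_pair (h : IsMemorylessSource P X Y) (N : ℕ) :
    iIndepFun (fun (i : Fin N) ω => ![X i ω, Y i ω]) P :=
  (h.indep.precomp (g := fun i : Fin N => (i : ℕ)) Fin.val_injective).comp _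
    fun _ => measurable_vecPair

omit [IsProbabilityMeasure P] in
lemma IsMemorylessSource.map_pair (h : IsMemorylessSource P X Y) (i : ℕ) :
    P.map (fun ω => ![X i ω, Y i ω]) = P.map fun ω => ![X 0 ω, Y 0 ω] :=
  ((h.ident i).comp measurable_vecPair).map_eq

/-- Presents a block as a linear image of N k independent nonsingular variables, to which the
general lower bound applies. -/
lemma IsMemorylessSource.map_block (h : IsMemorylessSource P X Y)
    (hM : PairModel P (fun ω => ![X 0 ω, Y 0 ω]) A ν S) (N : ℕ) :
    P.map (fun ω (i : Fin N) => ![X i ω, Y i ω])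
      = (Measure.pi fun p : Fin N × Fin k => ν p.2).map (blockLin A N) := by
  have := hM.isProbabilityMeasure
  rw [(iIndepFun_iff_map_fun_eq_pi_map fun i : Fin N => (h.measurable_pair i).aemeasurable).1
    (h.iIndepFun_pair N), map_blockLin_pi ν A]
  congr 1
  funext i
  rw [h.map_pair, hM.map_eq]

/-- The pair of the rows of a block of pairs. -/
def rows {N : ℕ} (u : Fin N → Fin 2 → ℝ) : (Fin N → ℝ) × (Fin N → ℝ) :=
  (fun i => u i 0, fun i => u i 1)

lemma measurable_rows {N : ℕ} : Measurable (rows (N := N)) := by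
  unfold rows
  fun_prop

lemma rows_injective {N : ℕ} : Function.Injective (rows (N := N)) := by
  intro u v h
  simp only [rows, Prod.mk.injEq] at h
  funext i j
  fin_cases j
  · exact congrFun h.1 i
  · exact congrFun h.2 i

/-- Entropy adds up over independent samples, and regrouping the samples into two rows is injective.
-/
lemma IsMemorylessSource.entropy_block (h : IsMemorylessSource P X Y) (N q : ℕ) :
    entropy (P.map fun ω => (quantVec q (block X N ω), quantVec q (block Y N ω)))
      = N * entropy (P.map fun ω => quantVec q ![X 0 ω, Y 0 ω]) := by
  have hm : ∀ i : Fin N, Measurable fun ω => quantVec q ![X i ω, Y i ω] :=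
    fun i => (measurable_quantVec q).comp (h.measurable_pair i)
  have h1 := entropy_map_comp_of_injective P (D := fun ω (i : Fin N) => quantVec q ![X i ω, Y i ω])
    (measurable_pi_lambda _ hm) (Set.countable_univ_pi fun _ => countable_range_quantVec q)
    (fun ω i _ => ⟨_, rfl⟩) measurable_rows rows_injective
  have h2 : (fun ω => rows fun i : Fin N => quantVec q ![X i ω, Y i ω])
      = fun ω => (quantVec q (block X N ω), quantVec q (block Y N ω)) := rfl
  have h3 := entropy_map_pi P hm (countable_range_quantVec q) (fun i ω => ⟨_, rfl⟩)
    ((h.iIndepFun_pair N).comp _ fun _ => measurable_quantVec q)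
  have h4 : ∀ i : Fin N, P.map (fun ω => quantVec q ![X i ω, Y i ω])
      = P.map fun ω => quantVec q ![X 0 ω, Y 0 ω] := fun i =>
    (Measure.map_map (measurable_quantVec q) (h.measurable_pair i)).symm.trans
      ((congrArg (Measure.map (quantVec q)) (h.map_pair i)).trans
        (Measure.map_map (measurable_quantVec q) (h.measurable_pair 0)))
  rw [← h2, h1, h3]
  simp [h4]

/-- The conditional information dimension of a block given linear measurements is at least the mean
dimension of a family of subspaces, diminished by the number of measurements that matter on it. -/
lemma IsMemorylessSource.le_liminf_condEntropy (h : IsMemorylessSource P X Y)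
    (hM : PairModel P (fun ω => ![X 0 ω, Y 0 ω]) A ν S) {N mx my : ℕ}
    (Φx : Matrix (Fin mx) (Fin N) ℝ) (Φy : Matrix (Fin my) (Fin N) ℝ)
    (U : Set (Fin k) → Submodule ℝ (Fin 2 → ℝ)) (hU : ∀ T, U T ≤ imageSpace A T)
    {F : Type*} [AddCommGroup F] [Module ℝ F] [FiniteDimensional ℝ F]
    (ψ : (Fin N → Fin 2 → ℝ) →ₗ[ℝ] F)
    (hψ : ∀ u : Fin N → Fin 2 → ℝ, (∀ i, ∃ T, u i ∈ U T) → ψ u = 0 →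
      Φx.mulVec (rows u).1 = 0 ∧ Φy.mulVec (rows u).2 = 0) :
    N * meanDim ν S U ≤ liminf (fun q : ℕ =>
      condEntropy P (fun ω => (quantVec q (block X N ω), quantVec q (block Y N ω)))
        (fun ω => (Φx.mulVec (block X N ω), Φy.mulVec (block Y N ω)))
        / ENNReal.ofReal (Real.logb 2 (q : ℝ))) atTop + Module.finrank ℝ F := by
  have := hM.isProbabilityMeasure
  let ν' : Fin N × Fin k → Measure ℝ := fun p => ν p.2
  let S' : Fin N × Fin k → Set ℝ := fun p => S p.2
  -- Block directions that both measurements annihilate: on the product of the subspaces, ψ = 0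
  -- already implies this.
  let V : Set (Fin N × Fin k) → Submodule ℝ (Fin N → Fin 2 → ℝ) := fun T =>
    Submodule.pi Set.univ (fun i => U {j | (i, j) ∈ T}) ⊓ LinearMap.ker ψ
  let D : ℕ → (Fin N → Fin 2 → ℝ) → (Fin N → ℝ) × (Fin N → ℝ) := fun q u =>
    (quantVec q (rows u).1, quantVec q (rows u).2)
  let W : (Fin N → Fin 2 → ℝ) → (Fin mx → ℝ) × (Fin my → ℝ) := fun u =>
    (Φx.mulVec (rows u).1, Φy.mulVec (rows u).2)
  have hDm : ∀ q, Measurable (D q) := fun q =>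
    ((measurable_quantVec q).comp (_root_.measurable_fst.comp measurable_rows)).prodMk
      ((measurable_quantVec q).comp (_root_.measurable_snd.comp measurable_rows))
  have hmulVec : ∀ {m : ℕ} (Φ : Matrix (Fin m) (Fin N) ℝ), Measurable fun x => Φ.mulVec x :=
    fun Φ => measurable_linearMap Φ.mulVecLin
  have hWm : Measurable W :=
    ((hmulVec Φx).comp (_root_.measurable_fst.comp measurable_rows)).prodMk
      ((hmulVec Φy).comp (_root_.measurable_snd.comp measurable_rows))
  have hBm : Measurable (blockLin A N) := measurable_linearMap _
  have hres : ∀ T, ∃ G : (Fin (Module.finrank ℝ (V T)) → ℝ) →ₗ[ℝ] (Fin N × Fin k → ℝ),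
      IsResolved (fun q z => D q (blockLin A N z)) (fun z => W (blockLin A N z)) T G := fun T => by
    refine exists_isResolved (blockLin A N) (V T)
      (inf_le_left.trans (pi_le_map_blockLin A T _ fun i => hU _)) (fun z u hu => ?_)
      fun q hq z z' _ hD => ?_
    · obtain ⟨h1, h2⟩ := hψ (blockLin A N u) (fun i => ⟨_, hu.1 i trivial⟩) hu.2
      rw [map_add]
      have h3 : ∀ {m : ℕ} (Φ : Matrix (Fin m) (Fin N) ℝ) (a b : Fin N → ℝ), Φ.mulVec b = 0 →
          Φ.mulVec (a + b) = Φ.mulVec a := fun Φ a b hb => by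
        rw [Matrix.mulVec_add, hb, add_zero]
      exact Prod.ext (h3 Φx _ _ h1) (h3 Φy _ _ h2)
    · have hq0 : (0 : ℝ) ≤ 1 / q := by positivity
      rw [pi_norm_le_iff_of_nonneg hq0]
      intro i
      rw [pi_norm_le_iff_of_nonneg hq0]
      intro l
      rw [map_sub]
      fin_cases l
      · exact abs_sub_le_of_quant_eq hq (congrFun (congrArg Prod.fst hD) i)
      · exact abs_sub_le_of_quant_eq hq (congrFun (congrArg Prod.snd hD) i)
  choose G hG using hres
  have hlow := lintegral_le_liminf_condEntropy ν' (S := S')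
    (fun p => (hM.countable p.2).measurableSet) (fun p => hM.absolutelyContinuous p.2)
    (fun q => (hDm q).comp hBm) (hWm.comp hBm)
    (fun q => ⟨_, (countable_range_quantVec q).prod (countable_range_quantVec q),
      fun z => ⟨⟨_, rfl⟩, ⟨_, rfl⟩⟩⟩) _ G hG
  have hZm : Measurable fun ω (i : Fin N) => ![X i ω, Y i ω] :=
    measurable_pi_lambda _ fun i => h.measurable_pair i
  have htrans : ∀ q, condEntropy (Measure.pi ν') (fun z => D q (blockLin A N z))
      (fun z => W (blockLin A N z)) =
      condEntropy P (fun ω => (quantVec q (block X N ω), quantVec q (block Y N ω)))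
        (fun ω => (Φx.mulVec (block X N ω), Φy.mulVec (block Y N ω))) := fun q => by
    refine condEntropy_congr (Measure.pi ν') P ((hDm q).comp hBm)
      (D' := fun ω => D q fun i : Fin N => ![X i ω, Y i ω]) ((hDm q).comp hZm)
      (W' := fun ω => W fun i : Fin N => ![X i ω, Y i ω]) ?_
    exact (Measure.map_map (hWm.prodMk (hDm q)) hBm).symm.trans
      ((congrArg (Measure.map fun u => (W u, D q u)) (h.map_block hM N).symm).trans
        (Measure.map_map (hWm.prodMk (hDm q)) hZm))
  simp only [Function.comp_def, htrans] at hlow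
  -- Intersecting with ker ψ lowers the dimension by at most dim F.
  have hdim : ∀ T, ∑ i : Fin N, Module.finrank ℝ (U {j | (i, j) ∈ T})
      ≤ Module.finrank ℝ (V T) + Module.finrank ℝ F := fun T => by
    rw [← finrank_submodule_pi, ← finrank_map_add_finrank_inf_ker _ ψ, add_comm]
    exact Nat.add_le_add_left (Submodule.finrank_le _) _
  have hfm : Measurable fun z : Fin k → ℝ => (Module.finrank ℝ (U (pattern S z)) : ℝ≥0∞) :=
    (measurable_of_countable fun T => ((Module.finrank ℝ (U T) : ℕ) : ℝ≥0∞)).comp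
      (measurable_pattern fun j => (hM.countable j).measurableSet)
  rw [meanDim, ← lintegral_sum_blocks ν _ hfm]
  calc _ ≤ ∫⁻ z, ((Module.finrank ℝ (V (pattern S' z)) : ℝ≥0∞) + Module.finrank ℝ F)
          ∂(Measure.pi ν') := by
        refine lintegral_mono fun z => ?_
        have h1 : (∑ i : Fin N, (Module.finrank ℝ (U (pattern S fun j => z (i, j))) : ℝ≥0∞))
            = ((∑ i : Fin N, Module.finrank ℝ (U {j | (i, j) ∈ pattern S' z}) : ℕ) : ℝ≥0∞) := by
          rw [Nat.cast_sum]
          rfl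
        rw [h1, ← Nat.cast_add]
        exact Nat.cast_le.2 (hdim _)
    _ = ∫⁻ z, (Module.finrank ℝ (V (pattern S' z)) : ℝ≥0∞) ∂(Measure.pi ν')
          + Module.finrank ℝ F := by
        rw [lintegral_add_right _ measurable_const, lintegral_const, measure_univ, mul_one]
    _ ≤ _ := add_le_add hlow le_rfl

/-- The trade-off between the number of measurements and the mean dimension at a fixed block
length. -/
lemma IsMemorylessSource.mul_meanDim_le (h : IsMemorylessSource P X Y)
    (hM : PairModel P (fun ω => ![X 0 ω, Y 0 ω]) A ν S) {N mx my : ℕ}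
    (Φx : Matrix (Fin mx) (Fin N) ℝ) (Φy : Matrix (Fin my) (Fin N) ℝ) {ε : ℝ≥0}
    (hε : limsup (fun q : ℕ =>
      condEntropy P (fun ω => (quantVec q (block X N ω), quantVec q (block Y N ω)))
          (fun ω => (Φx.mulVec (block X N ω), Φy.mulVec (block Y N ω))) /
        entropy (P.map fun ω => (quantVec q (block X N ω), quantVec q (block Y N ω)))) atTop
      ≤ (ε : ℝ≥0∞))
    (U : Set (Fin k) → Submodule ℝ (Fin 2 → ℝ)) (hU : ∀ T, U T ≤ imageSpace A T)
    {F : Type*} [AddCommGroup F] [Module ℝ F] [FiniteDimensional ℝ F]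
    (ψ : (Fin N → Fin 2 → ℝ) →ₗ[ℝ] F)
    (hψ : ∀ u : Fin N → Fin 2 → ℝ, (∀ i, ∃ T, u i ∈ U T) → ψ u = 0 →
      Φx.mulVec (rows u).1 = 0 ∧ Φy.mulVec (rows u).2 = 0) :
    N * meanDim ν S U ≤ ε * (N * meanDim ν S (imageSpace A)) + Module.finrank ℝ F := by
  refine (h.le_liminf_condEntropy hM Φx Φy U hU ψ hψ).trans (add_le_add ?_ le_rfl)
  have htop : (N : ℝ≥0∞) * meanDim ν S (imageSpace A) ≠ ∞ :=
    ENNReal.mul_ne_top (ENNReal.natCast_ne_top N) (meanDim_ne_top hM _)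
  -- A limsup at most ε bounds the ratio eventually only by each η > ε; at the end η decreases to ε.
  have hη : ∀ η : ℝ≥0, ε < η → liminf (fun q : ℕ =>
      condEntropy P (fun ω => (quantVec q (block X N ω), quantVec q (block Y N ω)))
        (fun ω => (Φx.mulVec (block X N ω), Φy.mulVec (block Y N ω)))
        / ENNReal.ofReal (Real.logb 2 (q : ℝ))) atTop
      ≤ η * (N * meanDim ν S (imageSpace A)) := by
    intro η hη
    have hlim := ENNReal.Tendsto.const_mul (a := (η : ℝ≥0∞)) (ENNReal.Tendsto.const_mul
      (a := (N : ℝ≥0∞)) hM.tendsto_entropy (Or.inr (ENNReal.natCast_ne_top N)))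
      (Or.inr ENNReal.coe_ne_top)
    rw [← hlim.liminf_eq]
    refine liminf_le_liminf ?_
    filter_upwards [eventually_lt_of_limsup_lt (hε.trans_lt (ENNReal.coe_lt_coe.2 hη)),
      eventually_ge_atTop 1] with q hlt hq
    rw [h.entropy_block] at hlt
    have hE : (N : ℝ≥0∞) * entropy (P.map fun ω => quantVec q ![X 0 ω, Y 0 ω]) ≠ ∞ :=
      ENNReal.mul_ne_top (ENNReal.natCast_ne_top N) (hM.entropy_ne_top hq)
    -- The block entropy may vanish; since η is finite, the numerator must then vanish too.
    have hle := (ENNReal.div_le_iff_le_mul (Or.inr ENNReal.coe_ne_top) (Or.inl hE)).1 hlt.le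
    refine (ENNReal.div_le_div_right hle _).trans ?_
    rw [mul_div_assoc, mul_div_assoc]
  have hlim : Tendsto (fun η : ℝ≥0 => (η : ℝ≥0∞) * (N * meanDim ν S (imageSpace A)))
      (𝓝[>] ε) (𝓝 (ε * (N * meanDim ν S (imageSpace A)))) :=
    ENNReal.Tendsto.mul_const ((ENNReal.tendsto_coe.2 tendsto_id).mono_left nhdsWithin_le_nhds)
      (Or.inr htop)
  exact ge_of_tendsto hlim (eventually_mem_nhdsWithin.mono fun η h => hη η h)

end Source

/-! ### Limits in the block length and assembly of the theorem. -/

/-- Passage to the limit of the block lengths in a bound on the number of measurements. -/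
lemma le_of_forall_mul_le {N m : ℕ → ℕ} (hN : StrictMono N) {a b : ℝ≥0∞} {ρ : ℝ≥0}
    (hρ : limsup (fun l => (m l : ℝ≥0∞) / (N l : ℝ≥0∞)) atTop ≤ ρ)
    (h : ∀ l, (N l : ℝ≥0∞) * a ≤ N l * b + m l) : a ≤ b + ρ := by
  refine ENNReal.le_of_forall_pos_le_add fun η hη _ => ?_
  have h1 : (ρ : ℝ≥0∞) < ρ + η := ENNReal.lt_add_right ENNReal.coe_ne_top (by simpa using hη.ne')
  -- The condition l ≥ 1 ensures N l ≥ l > 0, while `N 0` may be 0.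
  obtain ⟨l, hl, hl1⟩ := ((eventually_lt_of_limsup_lt (hρ.trans_lt h1)).and
    (eventually_ge_atTop 1)).exists
  have hN0 : (N l : ℝ≥0∞) ≠ 0 := by
    have := hN.le_apply (x := l)
    exact Nat.cast_ne_zero.2 (by omega)
  have hNt : (N l : ℝ≥0∞) ≠ ∞ := ENNReal.natCast_ne_top _
  have h2 : a ≤ b + (m l : ℝ≥0∞) / N l := by
    rw [← ENNReal.mul_le_mul_iff_right hN0 hNt, mul_add, ENNReal.mul_div_cancel hN0 hNt]
    exact h l
  rw [add_assoc]
  exact h2.trans (add_le_add le_rfl hl.le)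

lemma limsup_add_le_add {u v : ℕ → ℝ≥0∞} {a b : ℝ≥0} (hu : limsup u atTop ≤ a)
    (hv : limsup v atTop ≤ b) : limsup (fun l => u l + v l) atTop ≤ a + b := by
  refine ENNReal.le_of_forall_pos_le_add fun η hη _ => ?_
  have h : ∀ c : ℝ≥0, (c : ℝ≥0∞) < c + (η / 2 : ℝ≥0) := fun c =>
    ENNReal.lt_add_right ENNReal.coe_ne_top (ENNReal.coe_ne_zero.2 (half_pos hη).ne')
  refine limsup_le_of_le (by isBoundedDefault) ?_
  filter_upwards [eventually_lt_of_limsup_lt (hu.trans_lt (h a)),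
    eventually_lt_of_limsup_lt (hv.trans_lt (h b))] with l h1 h2
  refine (add_le_add h1.le h2.le).trans (le_of_eq ?_)
  rw [add_add_add_comm, ← ENNReal.coe_add (η / 2), add_halves]

/-- The measurement of one row of a block of pairs. -/
def rowMeasurement {m N : ℕ} (Φ : Matrix (Fin m) (Fin N) ℝ) (l : Fin 2) :
    (Fin N → Fin 2 → ℝ) →ₗ[ℝ] (Fin m → ℝ) :=
  Φ.mulVecLin ∘ₗ LinearMap.pi fun i => LinearMap.proj l ∘ₗ LinearMap.proj i

lemma exists_pairModel {Ω : Type*} [MeasurableSpace Ω] {P : Measure Ω} [IsProbabilityMeasure P]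
    {X Y : ℕ → Ω → ℝ} (hXY : IsMemorylessSource P X Y)
    (hL : MemL P (fun ω => ![X 0 ω, Y 0 ω])) (hX2 : MemLp (X 0) 2 P) (hY2 : MemLp (Y 0) 2 P) :
    ∃ (k : ℕ) (A : (Fin k → ℝ) →ₗ[ℝ] (Fin 2 → ℝ)) (ν : Fin k → Measure ℝ) (S : Fin k → Set ℝ),
      PairModel P (fun ω => ![X 0 ω, Y 0 ω]) A ν S := by
  obtain ⟨k, A, ν, hν, hns, hmap⟩ := hL
  choose S hS hac using fun j => (hns j).exists_countable
  refine ⟨k, A.mulVecLin, ν, S, hXY.measurable_pair 0, hν, hS, hac, hmap, fun i => ?_⟩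
  fin_cases i
  · exact hX2.integrable (by norm_num)
  · exact hY2.integrable (by norm_num)

end

end RenyiDim

open RenyiDim in
theorem mainTheorem7 {Ω : Type*} [MeasurableSpace Ω] (P : Measure Ω) [IsProbabilityMeasure P]
    (X Y : ℕ → Ω → ℝ) (hXY : RenyiDim.IsMemorylessSource P X Y)
    (hL : RenyiDim.MemL P (fun ω => ![X 0 ω, Y 0 ω]))
    (hX2 : MemLp (X 0) 2 P) (hY2 : MemLp (Y 0) 2 P)
    (N mx my : ℕ → ℕ)
    (Φx : ∀ l, Matrix (Fin (mx l)) (Fin (N l)) ℝ) (Φy : ∀ l, Matrix (Fin (my l)) (Fin (N l)) ℝ)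
    (ε ρx ρy : ℝ≥0) (hREP : RenyiDim.IsREP P X Y N mx my Φx Φy ε ρx ρy) :
    ∃ dXY dXgY dYgX : ℝ≥0,
      RenyiDim.HasRID P (fun ω => ![X 0 ω, Y 0 ω]) dXY ∧
      RenyiDim.HasCondRID P (fun ω => ![X 0 ω]) (Y 0) dXgY ∧
      RenyiDim.HasCondRID P (fun ω => ![Y 0 ω]) (X 0) dYgX ∧
      (dXY : ℝ) * (1 - ε) ≤ ρx + ρy ∧
      (dXgY : ℝ) - ε * dXY ≤ ρx ∧
      (dYgX : ℝ) - ε * dXY ≤ ρy := by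
  obtain ⟨k, A, ν, S, hM⟩ := exists_pairModel hXY hL hX2 hY2
  -- The directions left when component `j` is frozen; their mean dimension is the conditional
  -- information dimension given that component.
  let U : Fin 2 → Set (Fin k) → Submodule ℝ (Fin 2 → ℝ) := fun j T =>
    imageSpace A T ⊓ LinearMap.ker (coordLin j)
  have hfin : ∀ V : Set (Fin k) → Submodule ℝ (Fin 2 → ℝ), ∃ d : ℝ≥0,
      (d : ℝ≥0∞) = meanDim ν S V := fun V => ⟨_, ENNReal.coe_toNNReal (meanDim_ne_top hM V)⟩
  obtain ⟨dXY, hdXY⟩ := hfin (imageSpace A)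
  obtain ⟨dX, hdX⟩ := hfin (U 1)
  obtain ⟨dY, hdY⟩ := hfin (U 0)
  have hrow : ∀ {n m : ℕ} (Φ : Matrix (Fin m) (Fin n) ℝ) (j : Fin 2) (u : Fin n → Fin 2 → ℝ),
      (∀ i, ∃ T, u i ∈ U j T) → Φ.mulVec (fun i => u i j) = 0 := by
    intro n m Φ j u hu
    have h0 : (fun i => u i j) = 0 := by
      funext i
      obtain ⟨T, hT⟩ := hu i
      exact coordLin_eq_zero.1 hT.2
    rw [h0, Matrix.mulVec_zero]
  have hXYle : dXY ≤ ε * dXY + (ρx + ρy) := by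
    have hlim : limsup (fun l => ((mx l + my l : ℕ) : ℝ≥0∞) / (N l : ℝ≥0∞)) atTop
        ≤ ((ρx + ρy : ℝ≥0) : ℝ≥0∞) := by
      simp only [Nat.cast_add, ENNReal.add_div, ENNReal.coe_add]
      exact limsup_add_le_add hREP.rate_fst hREP.rate_snd
    have h := le_of_forall_mul_le hREP.index hlim (a := dXY) (b := ε * dXY) fun l => by
      have := hXY.mul_meanDim_le hM (Φx l) (Φy l) (hREP.isometry l) (imageSpace A)
        (fun _ => le_rfl) ((rowMeasurement (Φx l) 0).prod (rowMeasurement (Φy l) 1))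
        fun u _ hu => ⟨congrArg Prod.fst hu, congrArg Prod.snd hu⟩
      rwa [Module.finrank_prod, Module.finrank_fin_fun, Module.finrank_fin_fun, ← hdXY,
        mul_left_comm] at this
    exact_mod_cast h
  -- On `U 1` the second row of the block vanishes, so `Φy` imposes nothing and only the `mx l`
  -- equations of `Φx` reduce the dimension.
  have hXle : dX ≤ ε * dXY + ρx := by
    have h := le_of_forall_mul_le hREP.index hREP.rate_fst (a := dX) (b := ε * dXY) fun l => by
      have := hXY.mul_meanDim_le hM (Φx l) (Φy l) (hREP.isometry l) (U 1)
        (fun _ => inf_le_left) (rowMeasurement (Φx l) 0)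
        fun u hu h0 => ⟨h0, hrow (Φy l) 1 u hu⟩
      rwa [Module.finrank_fin_fun, ← hdXY, ← hdX, mul_left_comm] at this
    exact_mod_cast h
  have hYle : dY ≤ ε * dXY + ρy := by
    have h := le_of_forall_mul_le hREP.index hREP.rate_snd (a := dY) (b := ε * dXY) fun l => by
      have := hXY.mul_meanDim_le hM (Φx l) (Φy l) (hREP.isometry l) (U 0)
        (fun _ => inf_le_left) (rowMeasurement (Φy l) 1)
        fun u hu h0 => ⟨hrow (Φx l) 0 u hu, h0⟩
      rwa [Module.finrank_fin_fun, ← hdXY, ← hdY, mul_left_comm] at this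
    exact_mod_cast h
  refine ⟨dXY, dX, dY, ?_, ?_, ?_, ?_, ?_, ?_⟩
  · rw [HasRID, hdXY]
    exact hM.tendsto_entropy
  · rw [HasCondRID, hdX]
    exact hM.tendsto_condEntropy (i := 0) (j := 1) (by decide)
  · rw [HasCondRID, hdY]
    exact hM.tendsto_condEntropy (i := 1) (j := 0) (by decide)
  · have h : (dXY : ℝ) ≤ ε * dXY + (ρx + ρy) := by exact_mod_cast hXYle
    linarith
  · have h : (dX : ℝ) ≤ ε * dXY + ρx := by exact_mod_cast hXle
    linarith
  · have h : (dY : ℝ) ≤ ε * dXY + ρy := by exact_mod_cast hYle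
    linarith
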